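/- **Setting.** A fluid timed Petri net without priority rules has a finite set $\mathcal P$ of places, a finite set $\mathcal Q$ of transitions, arcs with positive real weights ($\alpha_{qp}$ for an arc from the place $p$ to the transition $q$, $\alpha_{pq}$ for an arc from $q$ to $p$; the weight is $0$ if there is no arc), holding times $\tau_p\ge 0$, and a set of places ruled by preselection routing. Write $q^{\mathrm{in}}$ for the set of upstream places of $q$, assumed nonempty. Each preselection place $p$ carries a stochastic vector $(\pi_{qp})$ indexed by its downstream transitions, and these have no other upstream place. Every other place has at most one downstream transition, for which we put $\pi_{qp}=1$. For an initial marking $m\in(\mathbb R_{\ge 0})^{\mathcal P}$, a trajectory is a function $z$, bounded on $[-T,0]$ with $T=\max_p\tau_p$, such that for all $t>0$ and $q\in\mathcal Q$ $$z_q(t)=\min_{p\in q^{\mathrm{in}}}\pi_{qp}\alpha_{qp}^{-1}\Big(m_p+\sum_{q'\in\mathcal Q}\alpha_{pq'}\,z_{q'}(t-\tau_p)\Big).$$ **Assumption.** The net is non-Zeno (no circuit has only places with zero holding time), and $e$ is a positive stoichiometric invariant: $e_q>0$ and $e_q=\pi_{qp}\alpha_{qp}^{-1}\sum_{q'}\alpha_{pq'}e_{q'}$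 for all $q$ and all $p\in q^{\mathrm{in}}$. **Policies.** A policy is a map $\sigma:\mathcal Q\to\mathcal P$ with $\sigma(q)\in q^{\mathrm{in}}$ for all $q$. Let $P^\sigma$ be the stochastic matrix with entries $P^\sigma_{qq'}=e_q^{-1}\pi_{qp}\alpha_{qp}^{-1}\alpha_{pq'}e_{q'}$, $p=\sigma(q)$. Let $\mathcal F(\sigma)$ be the set of its final classes, $\mu^\sigma_F$ the unique invariant probability measure of $P^\sigma$ supported by $F$, $\phi^\sigma_{F,q}=\sum_{j\in F}P^{\sigma,\star}_{qj}$, where $P^{\sigma,\star}=\lim_n\frac1{n+1}\sum_{k=0}^n(P^\sigma)^k$, the probability of reaching $F$ from $q$. Put $m^\sigma=(m_{\sigma(q)})_q$, $\tau^\sigma=(\tau_{\sigma(q)})_q$, $D^\sigma=\mathrm{diag}(e_q^{-1}\alpha_{q\sigma(q)}^{-1}\pi_{q\sigma(q)})_q$. **Statement.** Under the assumption: 1. The quantities above are well defined: the Cesàro limits exist, $\mu^\sigma_F$ exists and is unique, and $\langle\mu^\sigma_F,\tau^\sigma\rangle>0$ for every policy $\sigma$ and every $F\in\mathcal F(\sigma)$.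 2. For every $m\in(\mathbb R_{\ge0})^{\mathcal P}$ there are trajectories, and there is a throughput vector $\rho=\rho(m)$ such that $z_q(t)/t\to\rho_q$ as $t\to\infty$ for every trajectory $z$ and every $q$. It is given by $$\rho_q=e_q\,\min_\sigma\ \sum_{F\in\mathcal F(\sigma)}\phi^\sigma_{F,q}\,\frac{\langle\mu^\sigma_F,D^\sigma m^\sigma\rangle}{\langle\mu^\sigma_F,\tau^\sigma\rangle}\qquad(q\in\mathcal Q),$$ the minimum being over all policies. 3. For every $q$, $\rho_q$ is a concave function of $m\in(\mathbb R_{\ge0})^{\mathcal P}$, and it is piecewise affine: $(\mathbb R_{\ge0})^{\mathcal P}$ is a finite union of polyhedra on each of which $\rho_q$ is affine. 4. Let $U\subseteq\mathcal Q$ (for instance $U=\{q\}$ or $U=\mathcal Q$). For a set $\Sigma$ of policies, let the cell $\mathcal C_\Sigma$ be the closure of the set of all $m\in(\mathbb R_{\ge0})^{\mathcal P}$ for which $\Sigma$ is exactly the set of policies attaining the minimum in the formula for every $q\in U$. Then the cells together with all their faces form a finite polyhedral complex (a finite collection of polyhedra, containing all faces of its members, in which the intersection of any two members is a face of both; the empty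 set counts as a face). The union of the complex is $(\mathbb R_{\ge0})^{\mathcal P}$, and $\rho_q$ is affine on each of its members for every $q\in U$. The cells with nonempty interior (the "congestion phases") already cover $(\mathbb R_{\ge0})^{\mathcal P}$. Moreover, any subset of $(\mathbb R_{\ge0})^{\mathcal P}$ with nonempty interior on which every $\rho_q$, $q\in U$, is affine is contained in one of the cells with nonempty interior. -/

import Mathlib

open Set Filter Topology

noncomputable section

/-! ### Finite Markov chains -/

section MarkovChains

variable {Q : Type*} [Fintype Q] [DecidableEq Q]

/-- The Cesàro means `(1 / (n + 1)) ∑_{k ≤ n} (A ^ k) i j` of the powers of a square matrix. -/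
def cesaroMean (A : Matrix Q Q ℝ) (i j : Q) (n : ℕ) : ℝ :=
  ((n : ℝ) + 1)⁻¹ * ∑ k ∈ Finset.range (n + 1), (A ^ k) i j

/-- The spectral projector of a stochastic matrix: the entrywise limit of the Cesàro means. -/
def spectralProjector (A : Matrix Q Q ℝ) : Matrix Q Q ℝ :=
  Matrix.of fun i j => limUnder atTop (cesaroMean A i j)

/-- `j` is accessible from `i` in the digraph of the matrix `A`. -/
def Accessible {Q : Type*} (A : Matrix Q Q ℝ) (i j : Q) : Prop :=
  Relation.ReflTransGen (fun a b => 0 < A a b) i j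

/-- A final class: a strongly connected component of the digraph of `A` whose elements
have no access to elements outside of it. -/
def IsFinalClass {Q : Type*} (A : Matrix Q Q ℝ) (F : Finset Q) : Prop :=
  (∃ i, ∀ j, j ∈ F ↔ Accessible A i j ∧ Accessible A j i) ∧
    ∀ i ∈ F, ∀ j, Accessible A i j → j ∈ F

open Classical in
/-- The collection of the final classes. -/
def finalClasses {Q : Type*} [Fintype Q] (A : Matrix Q Q ℝ) : Finset (Finset Q) :=
  Finset.univ.filter (IsFinalClass A)

/-- `μ` is an invariant (probability) measure of `A`, supported by `F`. -/
structure IsInvariantMeasureOn {Q : Type*} [Fintype Q] (A : Matrix Q Q ℝ) (F : Finset Q)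
    (μ : Q → ℝ) : Prop where
  nonneg : ∀ i, 0 ≤ μ i
  sum_one : ∑ i, μ i = 1
  invariant : ∀ j, ∑ i, μ i * A i j = μ j
  support : ∀ i, i ∉ F → μ i = 0

open Classical in
/-- The invariant measure supported by the final class `F`. -/
def invariantMeasure {Q : Type*} [Fintype Q] (A : Matrix Q Q ℝ) (F : Finset Q) : Q → ℝ :=
  if h : ∃ μ, IsInvariantMeasureOn A F μ then h.choose else 0

/-- The probability that the chain started at `i` ultimately reaches the final class `F`. -/
def absorptionProbability (A : Matrix Q Q ℝ) (F : Finset Q) (i : Q) : ℝ :=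
  ∑ j ∈ F, spectralProjector A i j

end MarkovChains

/-! ### Polyhedra and piecewise affine functions -/

section Polyhedra

variable {P : Type*}

/-- A polyhedron: the solution set of finitely many weak affine inequalities. -/
def IsPolyhedron (L : Set (P → ℝ)) : Prop :=
  ∃ s : Finset (((P → ℝ) →ₗ[ℝ] ℝ) × ℝ), L = {x | ∀ c ∈ s, c.1 x ≤ c.2}

/-- A finite polyhedral complex. The faces of a polyhedron are its exposed subsets; these include
the polyhedron itself and, by convention, the empty set. -/
structure IsPolyhedralComplex (K : Set (Set (P → ℝ))) : Prop where
  finite : K.Finite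
  polyhedron : ∀ L ∈ K, IsPolyhedron L
  face_mem : ∀ L ∈ K, ∀ G, IsExposed ℝ L G → G ∈ K
  inter_face : ∀ L₁ ∈ K, ∀ L₂ ∈ K, IsExposed ℝ L₁ (L₁ ∩ L₂) ∧ IsExposed ℝ L₂ (L₁ ∩ L₂)

/-- `f` coincides on `S` with an affine function. -/
def IsAffineOn (S : Set (P → ℝ)) (f : (P → ℝ) → ℝ) : Prop :=
  ∃ a : (P → ℝ) →ᵃ[ℝ] ℝ, EqOn f a S

/-- `S` is a finite union of polyhedra on each of which `f` is affine. -/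
def IsPiecewiseAffineOn (S : Set (P → ℝ)) (f : (P → ℝ) → ℝ) : Prop :=
  ∃ K : Set (Set (P → ℝ)), K.Finite ∧ (∀ L ∈ K, IsPolyhedron L) ∧ ⋃₀ K = S ∧
    ∀ L ∈ K, IsAffineOn L f

/-- The set `(ℝ₊)^P` of (fluid) initial markings. -/
def markings (P : Type*) : Set (P → ℝ) := {m | ∀ p, 0 ≤ m p}

end Polyhedra

/-! ### Fluid timed Petri nets without priority routing -/

/-- A fluid timed Petri net without priority rules, with set of places `P` and set of
transitions `Q` (the initial marking is kept apart). An arc is present if and only if its weight is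
positive. -/
structure FluidPetriNet (P Q : Type*) [Fintype P] [Fintype Q] where
  /-- the weight `α_{qp}` of the arc from the place `p` to the transition `q` -/
  inWeight : Q → P → ℝ
  /-- the weight `α_{pq}` of the arc from the transition `q` to the place `p` -/
  outWeight : P → Q → ℝ
  inWeight_nonneg : ∀ q p, 0 ≤ inWeight q p
  outWeight_nonneg : ∀ p q, 0 ≤ outWeight p q
  /-- the holding time `τ_p` -/
  holding : P → ℝ
  holding_nonneg : ∀ p, 0 ≤ holding p
  /-- the places ruled by preselection routing -/
  psel : Set P
  /-- the proportion `π_{qp}` of the tokens of `p` that are reserved for `q`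
  (used for `p` in `psel` and `q` downstream of `p`) -/
  proportion : Q → P → ℝ
  proportion_nonneg : ∀ p ∈ psel, ∀ q, 0 < inWeight q p → 0 ≤ proportion q p
  proportion_sum : ∀ p ∈ psel, (open Classical in
    ∑ q ∈ Finset.univ.filter (fun q => 0 < inWeight q p), proportion q p) = 1
  /-- a transition downstream of a preselection place has no other upstream place -/
  psel_upstream : ∀ p ∈ psel, ∀ q, 0 < inWeight q p → ∀ p', 0 < inWeight q p' → p' = p
  /-- a place without routing rule has at most one downstream transition -/
  downstream_unique : ∀ p, p ∉ psel → ∀ q q', 0 < inWeight q p → 0 < inWeight q' p → q = q'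
  /-- every transition has an upstream place -/
  exists_upstream : ∀ q, ∃ p, 0 < inWeight q p

namespace FluidPetriNet

variable {P Q : Type*} [Fintype P] [Fintype Q] (N : FluidPetriNet P Q)

/-- The set of the upstream places of a transition. -/
def upstream (q : Q) : Set P := {p | 0 < N.inWeight q p}

open Classical in
/-- The proportions `π_{qp}`, extended by `1` to places that are not ruled by preselection. -/
def share (q : Q) (p : P) : ℝ := if p ∈ N.psel then N.proportion q p else 1

/-- The maximal holding time. -/
def maxHolding : ℝ := ⨆ p, N.holding p

/-- There is no circuit all of whose places have zero holding time. (A circuit alternates between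
transitions and places; a step goes from a transition `q'` to a transition `q` through `p`.) -/
def NonZeno : Prop :=
  ∀ q, ¬ Relation.TransGen
    (fun q' q => ∃ p, 0 < N.outWeight p q' ∧ 0 < N.inWeight q p ∧ N.holding p = 0) q q

/-- `e_q = π_{qp} α_{qp}⁻¹ ∑_{q'} α_{pq'} e_{q'}` for all `q` and all `p` upstream of `q`. -/
def IsStoichiometricInvariant (e : Q → ℝ) : Prop :=
  ∀ q, ∀ p ∈ N.upstream q,
    e q = N.share q p * (N.inWeight q p)⁻¹ * ∑ q', N.outWeight p q' * e q'

/-- `z` (with `z t q` the counter of the transition `q` at time `t`) is a trajectory of the fluid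
dynamics for the initial marking `m`, with a bounded initial condition on `[-T, 0]`, where `T` is the
maximal holding time. -/
structure IsTrajectory (m : P → ℝ) (z : ℝ → Q → ℝ) : Prop where
  initial_bounded : ∃ C, ∀ t ∈ Icc (-N.maxHolding) 0, ∀ q, |z t q| ≤ C
  dynamics : ∀ t, 0 < t → ∀ q,
    IsLeast ((fun p => N.share q p * (N.inWeight q p)⁻¹ *
      (m p + ∑ q', N.outWeight p q' * z (t - N.holding p) q')) '' N.upstream q) (z t q)

/-- `ρ` is the throughput vector for the initial marking `m`: whatever the initial condition,
`z_q(t) / t` tends to `ρ_q` as `t → ∞`. -/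
def IsThroughput (m : P → ℝ) (ρ : Q → ℝ) : Prop :=
  (∃ z, N.IsTrajectory m z) ∧
    ∀ z, N.IsTrajectory m z → ∀ q, Tendsto (fun t => z t q / t) atTop (𝓝 (ρ q))

/-- Policies: maps choosing an upstream place of each transition. -/
def Policy : Type _ := {σ : Q → P // ∀ q, σ q ∈ N.upstream q}

variable {N}

/-- The matrix `P^σ`, with entries `e_q⁻¹ π_{qp} α_{qp}⁻¹ α_{pq'} e_{q'}` where `p = σ q`. -/
def policyMatrix (e : Q → ℝ) (σ : N.Policy) : Matrix Q Q ℝ :=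
  Matrix.of fun q q' => (e q)⁻¹ *
    (N.share q (σ.1 q) * (N.inWeight q (σ.1 q))⁻¹ * N.outWeight (σ.1 q) q') * e q'

/-- The vector `D^σ m^σ`. -/
def policyCost (e : Q → ℝ) (σ : N.Policy) (m : P → ℝ) (q : Q) : ℝ :=
  (e q)⁻¹ * (N.inWeight q (σ.1 q))⁻¹ * N.share q (σ.1 q) * m (σ.1 q)

/-- The vector `τ^σ`. -/
def policyTime (σ : N.Policy) (q : Q) : ℝ := N.holding (σ.1 q)

variable [DecidableEq Q]

/-- `∑_F φ_{F,q} ⟨μ_F, D^σ m^σ⟩ / ⟨μ_F, τ^σ⟩`, the sum over the final classes `F` of `σ`. -/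
def policyValue (e : Q → ℝ) (σ : N.Policy) (m : P → ℝ) (q : Q) : ℝ :=
  ∑ F ∈ finalClasses (policyMatrix e σ),
    absorptionProbability (policyMatrix e σ) F q *
      ((invariantMeasure (policyMatrix e σ) F ⬝ᵥ policyCost e σ m) /
        (invariantMeasure (policyMatrix e σ) F ⬝ᵥ policyTime σ))

variable (N)

/-- The policies that attain, for every transition `q` in `U`, the minimum over all policies
of the value at `q`, for the initial marking `m`. -/
def optimalPolicies (e : Q → ℝ) (U : Set Q) (m : P → ℝ) : Set N.Policy :=
  {σ | ∀ q ∈ U, ∀ σ' : N.Policy, policyValue e σ m q ≤ policyValue e σ' m q}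

/-- The polyhedral cell of a set `S` of policies: the closure of the set of the initial markings for
which the argument of the minimum is exactly `S`. -/
def cell (e : Q → ℝ) (U : Set Q) (S : Set N.Policy) : Set (P → ℝ) :=
  closure {m | m ∈ markings P ∧ N.optimalPolicies e U m = S}

/-- The collection of all the cells and of all their faces. -/
def throughputComplex (e : Q → ℝ) (U : Set Q) : Set (Set (P → ℝ)) :=
  {G | ∃ S : Set N.Policy, IsExposed ℝ (N.cell e U S) G}

end FluidPetriNet

end

/-!
After normalization by the stoichiometric invariant, a counter is the value function of
a semi-Markov decision process with deterministic sojourn times: the states are the transitions, an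
action at `q` is an upstream place `p`, its cost is `placeCost`, its sojourn time is the holding
time of `p`, and `kernel` gives the next state. The policy value is the mean cost per unit of time.

*Fixed policy.* For a stochastic matrix `A`, the space is the direct sum of the kernel and the range
of `1 - A` (`exists_invariant_add_range`), which gives the Cesàro limit. Its row at a state
of a final class is the invariant measure of this class, as invariant functions are constant there,
and no row charges a state outside of the final classes. Hence the mean reward `g` satisfies
`A g = g`, and the projector kills `c - τ g`, so that there is a bias `u = c - τ g + A u`
(`exists_bias`).

*Optimal policy.* With discount factor `1 - r τ`, the non-Zeno condition gives a maximum principle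
(`nonneg_of_discounted_mulVec_le`), and the policy of least total value solves the Bellman
equation. By finiteness, one policy is optimal for a sequence `r → 0`, along which the values are
`g / r + O(1)`. The limits of the deviations along a subsequence provide a bias for which the
half-line `g t + u` satisfies the dynamics for `t` large (`exists_optimal_policy`). This policy
minimizes the value at all transitions simultaneously.

*Throughput.* Comparison with the half-line, by induction along the dynamics, shows that the
counters remain at bounded distance from it (`isThroughput_of_optimal`).

*Geometry.* The throughput is a minimum of finitely many linear functions of the marking. The cell
of a set `S` of policies is either empty or the polyhedron on which all policies in `S` are optimal
(`argminCell_eq_argminRegion`). Enlarging `S` selects a face of this polyhedron, so that two cells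
meet in a common face. Faces of polyhedra are the subsets given by tight inequalities, or the empty
set, which makes them finitely many and makes the face relation transitive. The covering by
full-dimensional cells and their maximality follow from a Baire argument and from the identity of
affine functions agreeing on an open set.
-/

/-! ### Stochastic matrices: averages, accessibility, the spectral projector -/

section Stochastic

open Matrix

variable {Q : Type*} [Fintype Q] [DecidableEq Q] {A : Matrix Q Q ℝ}

theorem rowStochastic_mulVec_le (hA : A ∈ rowStochastic ℝ Q) {x : Q → ℝ} {M : ℝ}
    (hx : ∀ j, x j ≤ M) (i : Q) : (A *ᵥ x) i ≤ M :=
  calc (A *ᵥ x) i ≤ ∑ j, A i j * M :=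
        Finset.sum_le_sum fun j _ =>
          mul_le_mul_of_nonneg_left (hx j) (nonneg_of_mem_rowStochastic hA)
    _ = M := by rw [← Finset.sum_mul, sum_row_of_mem_rowStochastic hA, one_mul]

theorem rowStochastic_le_mulVec (hA : A ∈ rowStochastic ℝ Q) {x : Q → ℝ} {M : ℝ}
    (hx : ∀ j, M ≤ x j) (i : Q) : M ≤ (A *ᵥ x) i :=
  calc M = ∑ j, A i j * M := by
        rw [← Finset.sum_mul, sum_row_of_mem_rowStochastic hA, one_mul]
    _ ≤ (A *ᵥ x) i :=
        Finset.sum_le_sum fun j _ =>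
          mul_le_mul_of_nonneg_left (hx j) (nonneg_of_mem_rowStochastic hA)

/-- The equality case of the maximum principle: if the average of `x` under row `i` is at most
a lower bound `M` of `x` on the successors of `i`, then `x` equals `M` on these successors. -/
theorem eq_of_mulVec_le (hA : A ∈ rowStochastic ℝ Q) {x : Q → ℝ} {M : ℝ} {i : Q}
    (hx : ∀ j, 0 < A i j → M ≤ x j) (h : (A *ᵥ x) i ≤ M) {j : Q} (hj : 0 < A i j) :
    x j = M := by
  have hterm : ∀ k ∈ Finset.univ, 0 ≤ A i k * (x k - M) := by
    intro k _
    rcases (nonneg_of_mem_rowStochastic hA : 0 ≤ A i k).eq_or_lt with h0 | h0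
    · simp [← h0]
    · exact mul_nonneg h0.le (sub_nonneg.2 (hx k h0))
  have hsum : ∑ k, A i k * (x k - M) ≤ 0 := by
    have : ∑ k, A i k * (x k - M) = (A *ᵥ x) i - M := by
      simp only [mul_sub, Finset.sum_sub_distrib, ← Finset.sum_mul,
        sum_row_of_mem_rowStochastic hA, one_mul]
      rfl
    linarith
  have h0 := (Finset.sum_eq_zero_iff_of_nonneg hterm).1
    (le_antisymm hsum (Finset.sum_nonneg hterm)) j (Finset.mem_univ j)
  rcases mul_eq_zero.1 h0 with h1 | h1 <;> linarith

theorem accessible_of_pow_ne_zero (hA : A ∈ rowStochastic ℝ Q) (k : ℕ) {i j : Q}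
    (h : (A ^ k) i j ≠ 0) : Accessible A i j := by
  induction k generalizing j with
  | zero =>
    rw [pow_zero, one_apply] at h
    rw [show i = j by by_contra hij; simp [hij] at h]
    exact Relation.ReflTransGen.refl
  | succ k ih =>
    rw [pow_succ, mul_apply] at h
    obtain ⟨l, _, hl⟩ := Finset.exists_ne_zero_of_sum_ne_zero h
    have h1 : (A ^ k) i l ≠ 0 := left_ne_zero_of_mul hl
    have h2 : 0 < A l j :=
      lt_of_le_of_ne (nonneg_of_mem_rowStochastic hA) (right_ne_zero_of_mul hl).symm
    exact Relation.ReflTransGen.tail (ih h1) h2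

/-- The invariant vectors and the range of `1 - A` span the whole space: they intersect trivially
since the powers of `A` are bounded, and their dimensions are complementary. -/
theorem exists_invariant_add_range (hA : A ∈ rowStochastic ℝ Q) (v : Q → ℝ) :
    ∃ x y : Q → ℝ, A *ᵥ x = x ∧ v = x + (y - A *ᵥ y) := by
  set f : (Q → ℝ) →ₗ[ℝ] (Q → ℝ) := (1 - A).mulVecLin with hf
  have hfa : ∀ y, f y = y - A *ᵥ y := fun y => by simp [hf]
  have hdisj : Disjoint (LinearMap.ker f) (LinearMap.range f) := by
    rw [Submodule.disjoint_def]
    rintro x hx ⟨y, rfl⟩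
    rw [LinearMap.mem_ker] at hx
    set x := f y with hxy
    have hAx : A *ᵥ x = x := by
      have := hfa x
      rw [hx] at this
      exact (sub_eq_zero.1 this.symm).symm
    -- along the orbit of `y` the vector `x` accumulates linearly, while the orbit is bounded
    have hpow : ∀ n : ℕ, (A ^ n) *ᵥ y = y - (n : ℝ) • x := by
      intro n
      induction n with
      | zero => simp
      | succ n ih =>
        have hAy : A *ᵥ y = y - x := by rw [hxy, hfa]; abel
        rw [pow_succ', ← mulVec_mulVec, ih, mulVec_sub, mulVec_smul, hAx, hAy]
        push_cast
        module
    ext i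
    by_contra hxi
    obtain ⟨n, hn⟩ := exists_nat_gt (2 * ‖y‖ / |x i|)
    have hxpos : 0 < |x i| := abs_pos.2 hxi
    rw [div_lt_iff₀ hxpos] at hn
    have h1 := congrFun (hpow n) i
    have hb : ∀ j, |y j| ≤ ‖y‖ := fun j => norm_le_pi_norm y j
    have hAn := Submonoid.pow_mem _ hA n
    have h2 := rowStochastic_mulVec_le hAn (fun j => (abs_le.1 (hb j)).2) i
    have h3 := rowStochastic_le_mulVec hAn (fun j => (abs_le.1 (hb j)).1) i
    have h4 := abs_le.1 (hb i)
    simp only [Pi.sub_apply, Pi.smul_apply, smul_eq_mul] at h1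
    have h5 : |(n : ℝ) * x i| ≤ 2 * ‖y‖ := abs_le.2 ⟨by linarith, by linarith⟩
    rw [abs_mul, Nat.abs_cast] at h5
    linarith
  have htop := Submodule.eq_top_of_disjoint _ _
    (by rw [add_comm, LinearMap.finrank_range_add_finrank_ker]) hdisj
  obtain ⟨x, hx, z, ⟨y, rfl⟩, hv⟩ := Submodule.mem_sup.1 (htop ▸ Submodule.mem_top : v ∈ _)
  refine ⟨x, y, ?_, by rw [← hfa, hv]⟩
  rw [LinearMap.mem_ker, hfa] at hx
  exact (sub_eq_zero.1 hx).symm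

theorem sum_cesaroMean_mul (A : Matrix Q Q ℝ) (v : Q → ℝ) (i : Q) (n : ℕ) :
    ∑ j, cesaroMean A i j n * v j =
      ((n : ℝ) + 1)⁻¹ * ((∑ k ∈ Finset.range (n + 1), A ^ k) *ᵥ v) i := by
  simp only [cesaroMean, mulVec, dotProduct, Matrix.sum_apply, mul_assoc, ← Finset.mul_sum]

/-- The Cesàro averages of the orbit of `x + (y - A y)`, with `x` invariant, converge to `x`. -/
theorem tendsto_cesaroMean_mulVec (hA : A ∈ rowStochastic ℝ Q) {x y : Q → ℝ}
    (hx : A *ᵥ x = x) (i : Q) :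
    Tendsto (fun n => ∑ j, cesaroMean A i j n * (x + (y - A *ᵥ y)) j) atTop (𝓝 (x i)) := by
  have hxk : ∀ k : ℕ, (A ^ k) *ᵥ x = x := fun k => by
    induction k with
    | zero => simp
    | succ k ih => rw [pow_succ, ← mulVec_mulVec, hx, ih]
  have hsum : ∀ n : ℕ, ∑ j, cesaroMean A i j n * (x + (y - A *ᵥ y)) j =
      x i + ((n : ℝ) + 1)⁻¹ * (y i - ((A ^ (n + 1)) *ᵥ y) i) := by
    intro n
    have hn : ((n : ℝ) + 1) ≠ 0 := by positivity
    have h1 : (∑ k ∈ Finset.range (n + 1), A ^ k) *ᵥ x = ((n : ℝ) + 1) • x := by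
      rw [sum_mulVec]
      simp [hxk, ← Nat.cast_smul_eq_nsmul ℝ]
    have h2 : (∑ k ∈ Finset.range (n + 1), A ^ k) *ᵥ (y - A *ᵥ y) =
        y - (A ^ (n + 1)) *ᵥ y := by
      have : y - A *ᵥ y = (1 - A) *ᵥ y := by rw [sub_mulVec, one_mulVec]
      rw [this, mulVec_mulVec, geom_sum_mul_neg, sub_mulVec, one_mulVec]
    rw [sum_cesaroMean_mul, mulVec_add, h1, h2]
    simp only [Pi.add_apply, Pi.smul_apply, Pi.sub_apply, smul_eq_mul]
    field_simp
  simp only [hsum]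
  have hlim : Tendsto (fun n : ℕ => ((n : ℝ) + 1)⁻¹ * (2 * ‖y‖)) atTop (𝓝 0) := by
    have := (tendsto_one_div_add_atTop_nhds_zero_nat (𝕜 := ℝ)).mul_const (2 * ‖y‖)
    simpa using this
  have h0 : Tendsto (fun n : ℕ => ((n : ℝ) + 1)⁻¹ * (y i - ((A ^ (n + 1)) *ᵥ y) i)) atTop
      (𝓝 0) := by
    refine squeeze_zero_norm (fun n => ?_) hlim
    have hb : ∀ j, |y j| ≤ ‖y‖ := fun j => norm_le_pi_norm y j
    have hAn := Submonoid.pow_mem _ hA (n + 1)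
    have h2 := rowStochastic_mulVec_le hAn (fun j => (abs_le.1 (hb j)).2) i
    have h3 := rowStochastic_le_mulVec hAn (fun j => (abs_le.1 (hb j)).1) i
    have h4 := abs_le.1 (hb i)
    have hp : (0 : ℝ) < ((n : ℝ) + 1)⁻¹ := by positivity
    rw [norm_mul, Real.norm_of_nonneg hp.le]
    refine mul_le_mul_of_nonneg_left (abs_le.2 ⟨by linarith, by linarith⟩) hp.le
  simpa using h0.const_add (x i)

theorem tendsto_cesaroMean (hA : A ∈ rowStochastic ℝ Q) (i j : Q) :
    Tendsto (cesaroMean A i j) atTop (𝓝 (spectralProjector A i j)) := by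
  obtain ⟨x, y, hx, hv⟩ := exists_invariant_add_range hA (Pi.single j 1)
  have h := tendsto_cesaroMean_mulVec hA (y := y) hx i
  rw [← hv] at h
  simp only [Pi.single_apply, mul_ite, mul_one, mul_zero, Finset.sum_ite_eq',
    Finset.mem_univ, if_true] at h
  exact tendsto_nhds_limUnder ⟨_, h⟩

theorem spectralProjector_mulVec (hA : A ∈ rowStochastic ℝ Q) {x y : Q → ℝ}
    (hx : A *ᵥ x = x) : spectralProjector A *ᵥ (x + (y - A *ᵥ y)) = x := by
  ext i
  refine tendsto_nhds_unique ?_ (tendsto_cesaroMean_mulVec hA (y := y) hx i)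
  exact tendsto_finsetSum _ fun j _ => (tendsto_cesaroMean hA i j).mul_const _

theorem spectralProjector_mulVec_of_invariant (hA : A ∈ rowStochastic ℝ Q) {x : Q → ℝ}
    (hx : A *ᵥ x = x) : spectralProjector A *ᵥ x = x := by
  simpa using spectralProjector_mulVec hA (y := 0) hx

theorem mulVec_spectralProjector_mulVec (hA : A ∈ rowStochastic ℝ Q) (v : Q → ℝ) :
    A *ᵥ (spectralProjector A *ᵥ v) = spectralProjector A *ᵥ v := by
  obtain ⟨x, y, hx, rfl⟩ := exists_invariant_add_range hA v
  rw [spectralProjector_mulVec hA hx, hx]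

theorem spectralProjector_mul (hA : A ∈ rowStochastic ℝ Q) :
    spectralProjector A * A = spectralProjector A :=
  ext_of_mulVec_single fun j => by
    obtain ⟨x, y, hx, hv⟩ := exists_invariant_add_range hA (Pi.single j 1)
    rw [← mulVec_mulVec, hv, spectralProjector_mulVec hA hx, mulVec_add, mulVec_sub, hx,
      spectralProjector_mulVec hA hx]

theorem exists_eq_sub_of_spectralProjector_mulVec_eq_zero (hA : A ∈ rowStochastic ℝ Q)
    {v : Q → ℝ} (hv : spectralProjector A *ᵥ v = 0) : ∃ y, v = y - A *ᵥ y := by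
  obtain ⟨x, y, hx, rfl⟩ := exists_invariant_add_range hA v
  rw [spectralProjector_mulVec hA hx] at hv
  exact ⟨y, by rw [hv, zero_add]⟩

theorem spectralProjector_mem_rowStochastic (hA : A ∈ rowStochastic ℝ Q) :
    spectralProjector A ∈ rowStochastic ℝ Q := by
  rw [mem_rowStochastic]
  refine ⟨fun i j => ge_of_tendsto' (tendsto_cesaroMean hA i j) fun n => ?_,
    spectralProjector_mulVec_of_invariant hA (one_vecMul_of_mem_rowStochastic hA)⟩
  exact mul_nonneg (by positivity) (Finset.sum_nonneg fun k _ =>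
    nonneg_of_mem_rowStochastic (Submonoid.pow_mem _ hA k))

theorem accessible_of_spectralProjector_ne_zero (hA : A ∈ rowStochastic ℝ Q) {i j : Q}
    (h : spectralProjector A i j ≠ 0) : Accessible A i j := by
  by_contra hij
  refine h (tendsto_nhds_unique (tendsto_cesaroMean hA i j) ?_)
  have : cesaroMean A i j = fun _ => 0 := by
    ext n
    rw [cesaroMean, Finset.sum_eq_zero, mul_zero]
    intro k _
    by_contra hk
    exact hij (accessible_of_pow_ne_zero hA k hk)
  rw [this]
  exact tendsto_const_nhds

/-! ### Final classes and invariant measures -/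

theorem IsInvariantMeasureOn.vecMul_spectralProjector (hA : A ∈ rowStochastic ℝ Q)
    {F : Finset Q} {μ : Q → ℝ} (hμ : IsInvariantMeasureOn A F μ) :
    μ ᵥ* spectralProjector A = μ := by
  have hμA : μ ᵥ* A = μ := funext hμ.invariant
  ext j
  obtain ⟨x, y, hx, hv⟩ := exists_invariant_add_range hA (Pi.single j 1)
  have h : μ ⬝ᵥ (spectralProjector A *ᵥ Pi.single j 1) = μ ⬝ᵥ Pi.single j 1 := by
    rw [hv, spectralProjector_mulVec hA hx, dotProduct_add, dotProduct_sub,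
      dotProduct_mulVec μ A y, hμA, sub_self, add_zero]
  rwa [dotProduct_mulVec, dotProduct_single_one, dotProduct_single_one] at h

/-- The states charged by an invariant measure are recurrent. -/
theorem accessible_antisymm_of_invariant (hA : A ∈ rowStochastic ℝ Q) {ν : Q → ℝ}
    (hν0 : ∀ i, 0 ≤ ν i) (hν : ν ᵥ* A = ν) {i j : Q} (hi : 0 < ν i) (hij : Accessible A i j) :
    Accessible A j i := by
  classical
  -- no invariant mass enters the closed set `S` of the states with no access to `i`
  set S : Finset Q := Finset.univ.filter fun k => ¬ Accessible A k i with hS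
  have hmemS : ∀ k, k ∈ S ↔ ¬ Accessible A k i := fun k => by simp [hS]
  set s : Q → ℝ := fun k => if k ∈ S then 1 else 0 with hs
  have hclosed : ∀ l ∈ S, (A *ᵥ s) l = 1 := by
    intro l hl
    rw [← sum_row_of_mem_rowStochastic hA l]
    refine Finset.sum_congr rfl fun k _ => ?_
    by_cases hk : k ∈ S
    · simp [hs, hk]
    · have : A l k = 0 := by
        by_contra h0
        have hpos : 0 < A l k := lt_of_le_of_ne (nonneg_of_mem_rowStochastic hA) (Ne.symm h0)
        rw [hmemS, not_not] at hk
        exact (hmemS l).1 hl (Relation.ReflTransGen.head hpos hk)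
      simp [this]
  have hnn : ∀ l, 0 ≤ (A *ᵥ s) l - s l := by
    intro l
    by_cases hl : l ∈ S
    · rw [hclosed l hl]
      simp [hs, hl]
    · have : 0 ≤ (A *ᵥ s) l :=
        rowStochastic_le_mulVec hA (fun k => by simp only [hs]; split_ifs <;> norm_num) l
      simpa [hs, hl] using this
  have hflow : ∑ l, ν l * ((A *ᵥ s) l - s l) = 0 := by
    have h1 : ν ⬝ᵥ (A *ᵥ s) = ν ⬝ᵥ s := by rw [dotProduct_mulVec, hν]
    simp only [mul_sub, Finset.sum_sub_distrib]
    exact sub_eq_zero.2 h1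
  have hzero : ∀ l, ν l * ((A *ᵥ s) l - s l) = 0 := fun l =>
    (Finset.sum_eq_zero_iff_of_nonneg fun l _ => mul_nonneg (hν0 l) (hnn l)).1 hflow l
      (Finset.mem_univ l)
  have key : Accessible A j i ∧ 0 < ν j := by
    induction hij with
    | refl => exact ⟨Relation.ReflTransGen.refl, hi⟩
    | @tail k l _ hkl ih =>
      have hνl : 0 < ν l := by
        rw [← congrFun hν l]
        exact Finset.sum_pos' (fun k _ => mul_nonneg (hν0 k) (nonneg_of_mem_rowStochastic hA))
          ⟨k, Finset.mem_univ k, mul_pos ih.2 hkl⟩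
      refine ⟨?_, hνl⟩
      by_contra hl
      have hkS : k ∉ S := fun h => (hmemS k).1 h ih.1
      have h1 : (A *ᵥ s) k = 0 := by
        have := (mul_eq_zero.1 (hzero k)).resolve_left ih.2.ne'
        simpa [hs, hkS] using this
      have h2 : 0 < (A *ᵥ s) k :=
        Finset.sum_pos' (fun k' _ => mul_nonneg (nonneg_of_mem_rowStochastic hA)
            (by simp only [hs]; split_ifs <;> norm_num))
          ⟨l, Finset.mem_univ l, mul_pos hkl (by simp [hs, (hmemS l).2 hl])⟩
      exact h2.ne' h1
  exact key.1

theorem exists_finalClass_of_invariant (hA : A ∈ rowStochastic ℝ Q) {ν : Q → ℝ}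
    (hν0 : ∀ i, 0 ≤ ν i) (hν : ν ᵥ* A = ν) {i : Q} (hi : 0 < ν i) :
    ∃ F, IsFinalClass A F ∧ i ∈ F := by
  classical
  refine ⟨Finset.univ.filter fun j => Accessible A i j ∧ Accessible A j i,
    ⟨⟨i, fun j => by simp⟩, ?_⟩, ?_⟩
  · intro k hk j hkj
    simp only [Finset.mem_filter, Finset.mem_univ, true_and] at hk ⊢
    have hij := hk.1.trans hkj
    exact ⟨hij, accessible_antisymm_of_invariant hA hν0 hν hi hij⟩
  · simp only [Finset.mem_filter, Finset.mem_univ, true_and]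
    exact ⟨Relation.ReflTransGen.refl, Relation.ReflTransGen.refl⟩

theorem IsFinalClass.nonempty {Q : Type*} {A : Matrix Q Q ℝ} {F : Finset Q}
    (hF : IsFinalClass A F) : F.Nonempty := by
  obtain ⟨i, hi⟩ := hF.1
  exact ⟨i, (hi i).2 ⟨Relation.ReflTransGen.refl, Relation.ReflTransGen.refl⟩⟩

theorem IsFinalClass.accessible {Q : Type*} {A : Matrix Q Q ℝ} {F : Finset Q}
    (hF : IsFinalClass A F) {i j : Q} (hi : i ∈ F)
    (hj : j ∈ F) : Accessible A i j := by
  obtain ⟨k, hk⟩ := hF.1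
  exact ((hk i).1 hi).2.trans ((hk j).1 hj).1

theorem IsFinalClass.eq_of_mem {Q : Type*} {A : Matrix Q Q ℝ} {F G : Finset Q}
    (hF : IsFinalClass A F) (hG : IsFinalClass A G)
    {i : Q} (hiF : i ∈ F) (hiG : i ∈ G) : F = G := by
  ext j
  exact ⟨fun hj => hG.2 i hiG j (hF.accessible hiF hj),
    fun hj => hF.2 i hiF j (hG.accessible hiG hj)⟩

/-- An invariant function is constant on a final class. -/
theorem IsFinalClass.invariant_eq (hA : A ∈ rowStochastic ℝ Q) {F : Finset Q}
    (hF : IsFinalClass A F) {h : Q → ℝ} (hh : A *ᵥ h = h) {i j : Q} (hi : i ∈ F) (hj : j ∈ F) :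
    h i = h j := by
  obtain ⟨k, hk, hmin⟩ := F.exists_min_image h hF.nonempty
  have key : ∀ l, Accessible A k l → h l = h k := by
    intro l hl
    induction hl with
    | refl => rfl
    | @tail a b hka hab ih =>
      refine eq_of_mulVec_le hA (i := a) (fun c hc => ?_) (by rw [hh, ih]) hab
      exact hmin c (hF.2 k hk c (Relation.ReflTransGen.tail hka hc))
  rw [key i (hF.accessible hk hi), key j (hF.accessible hk hj)]

theorem spectralProjector_row_eq (hA : A ∈ rowStochastic ℝ Q) {F : Finset Q}
    (hF : IsFinalClass A F) {i i' : Q} (hi : i ∈ F) (hi' : i' ∈ F) (j : Q) :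
    spectralProjector A i j = spectralProjector A i' j := by
  have h := mulVec_spectralProjector_mulVec hA (Pi.single j 1)
  rw [mulVec_single_one] at h
  exact hF.invariant_eq hA h hi hi'

theorem isInvariantMeasureOn_spectralProjector (hA : A ∈ rowStochastic ℝ Q) {F : Finset Q}
    (hF : IsFinalClass A F) {i : Q} (hi : i ∈ F) :
    IsInvariantMeasureOn A F (spectralProjector A i) where
  nonneg _ := nonneg_of_mem_rowStochastic (spectralProjector_mem_rowStochastic hA)
  sum_one := sum_row_of_mem_rowStochastic (spectralProjector_mem_rowStochastic hA) i
  invariant j := by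
    conv_rhs => rw [← spectralProjector_mul hA]
    rfl
  support j hj := by
    by_contra h
    exact hj (hF.2 i hi j (accessible_of_spectralProjector_ne_zero hA h))

/-- The row `i` of the spectral projector is the only invariant measure supported by the final
class of `i`. -/
theorem IsInvariantMeasureOn.eq_spectralProjector (hA : A ∈ rowStochastic ℝ Q) {F : Finset Q}
    (hF : IsFinalClass A F) {i : Q} (hi : i ∈ F) {μ : Q → ℝ} (hμ : IsInvariantMeasureOn A F μ) :
    μ = spectralProjector A i := by
  ext j
  rw [← congrFun (hμ.vecMul_spectralProjector hA) j]
  calc ∑ k, μ k * spectralProjector A k j = ∑ k, μ k * spectralProjector A i j := by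
        refine Finset.sum_congr rfl fun k _ => ?_
        by_cases hk : k ∈ F
        · rw [spectralProjector_row_eq hA hF hk hi]
        · simp [hμ.support k hk]
    _ = spectralProjector A i j := by rw [← Finset.sum_mul, hμ.sum_one, one_mul]

theorem invariantMeasure_eq (hA : A ∈ rowStochastic ℝ Q) {F : Finset Q}
    (hF : IsFinalClass A F) {i : Q} (hi : i ∈ F) :
    invariantMeasure A F = spectralProjector A i := by
  have hex : ∃ μ, IsInvariantMeasureOn A F μ :=
    ⟨_, isInvariantMeasureOn_spectralProjector hA hF hi⟩
  rw [invariantMeasure, dif_pos hex]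
  exact hex.choose_spec.eq_spectralProjector hA hF hi

theorem isInvariantMeasureOn_iff (hA : A ∈ rowStochastic ℝ Q) {F : Finset Q}
    (hF : IsFinalClass A F) (μ : Q → ℝ) :
    IsInvariantMeasureOn A F μ ↔ μ = invariantMeasure A F := by
  obtain ⟨i, hi⟩ := hF.nonempty
  rw [invariantMeasure_eq hA hF hi]
  exact ⟨fun h => h.eq_spectralProjector hA hF hi,
    fun h => h ▸ isInvariantMeasureOn_spectralProjector hA hF hi⟩

theorem mulVec_absorptionProbability (hA : A ∈ rowStochastic ℝ Q) (F : Finset Q) :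
    A *ᵥ absorptionProbability A F = absorptionProbability A F := by
  have h : absorptionProbability A F =
      spectralProjector A *ᵥ fun j => (if j ∈ F then 1 else 0 : ℝ) := by
    ext i
    simp [absorptionProbability, mulVec, dotProduct]
  rw [h, mulVec_spectralProjector_mulVec hA]

theorem absorptionProbability_of_mem (hA : A ∈ rowStochastic ℝ Q) {F : Finset Q}
    (hF : IsFinalClass A F) {i : Q} (hi : i ∈ F) : absorptionProbability A F i = 1 := by
  have h := isInvariantMeasureOn_spectralProjector hA hF hi
  rw [absorptionProbability, ← h.sum_one]
  exact Finset.sum_subset (Finset.subset_univ F) fun j _ hj => h.support j hj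

theorem absorptionProbability_of_mem_of_ne (hA : A ∈ rowStochastic ℝ Q) {F G : Finset Q}
    (hF : IsFinalClass A F) (hG : IsFinalClass A G) (hFG : F ≠ G) {i : Q} (hi : i ∈ G) :
    absorptionProbability A F i = 0 := by
  have h := isInvariantMeasureOn_spectralProjector hA hG hi
  exact Finset.sum_eq_zero fun j hj => h.support j fun hjG => hFG (hF.eq_of_mem hG hj hjG)

/-! ### The evaluation equations of a fixed policy -/

theorem mem_finalClasses {Q : Type*} [Fintype Q] {A : Matrix Q Q ℝ} {F : Finset Q} :
    F ∈ finalClasses A ↔ IsFinalClass A F := by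
  simp [finalClasses]

/-- The mean reward per unit of time of the chain with transition matrix `A`, rewards `c` and
sojourn times `τ`, as a function of the initial state. -/
noncomputable def meanReward (A : Matrix Q Q ℝ) (c τ : Q → ℝ) (q : Q) : ℝ :=
  ∑ F ∈ finalClasses A, absorptionProbability A F q *
    ((invariantMeasure A F ⬝ᵥ c) / (invariantMeasure A F ⬝ᵥ τ))

theorem mulVec_meanReward (hA : A ∈ rowStochastic ℝ Q) (c τ : Q → ℝ) :
    A *ᵥ meanReward A c τ = meanReward A c τ := by
  have h : meanReward A c τ = ∑ F ∈ finalClasses A,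
      ((invariantMeasure A F ⬝ᵥ c) / (invariantMeasure A F ⬝ᵥ τ)) •
        absorptionProbability A F := by
    ext q
    simp [meanReward, Finset.sum_apply, mul_comm]
  rw [h, mulVec_sum]
  exact Finset.sum_congr rfl fun F _ => by rw [mulVec_smul, mulVec_absorptionProbability hA]

theorem meanReward_of_mem (hA : A ∈ rowStochastic ℝ Q) (c τ : Q → ℝ) {F : Finset Q}
    (hF : IsFinalClass A F) {i : Q} (hi : i ∈ F) :
    meanReward A c τ i = (invariantMeasure A F ⬝ᵥ c) / (invariantMeasure A F ⬝ᵥ τ) := by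
  rw [meanReward, Finset.sum_eq_single_of_mem F (mem_finalClasses.2 hF),
    absorptionProbability_of_mem hA hF hi, one_mul]
  intro G hG hGF
  rw [absorptionProbability_of_mem_of_ne hA (mem_finalClasses.1 hG) hF hGF hi, zero_mul]

/-- The spectral projector kills `c - τ g`, since on each final class `g` is the ratio that makes
the invariant average of `c - τ g` vanish, and since it only charges final classes. -/
theorem spectralProjector_mulVec_sub_meanReward (hA : A ∈ rowStochastic ℝ Q) (c τ : Q → ℝ)
    (hτ : ∀ F, IsFinalClass A F → invariantMeasure A F ⬝ᵥ τ ≠ 0) :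
    spectralProjector A *ᵥ (fun q => c q - τ q * meanReward A c τ q) = 0 := by
  set w : Q → ℝ := fun q => c q - τ q * meanReward A c τ q with hw
  have hB := spectralProjector_mem_rowStochastic hA
  have hclass : ∀ F, IsFinalClass A F → ∀ i ∈ F, (spectralProjector A *ᵥ w) i = 0 := by
    intro F hF i hi
    have hμ := isInvariantMeasureOn_spectralProjector hA hF hi
    have hinv := invariantMeasure_eq hA hF hi
    set r := (invariantMeasure A F ⬝ᵥ c) / (invariantMeasure A F ⬝ᵥ τ) with hr
    have h1 : (spectralProjector A *ᵥ w) i =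
        spectralProjector A i ⬝ᵥ c - (spectralProjector A i ⬝ᵥ τ) * r := by
      simp only [mulVec, dotProduct, Finset.sum_mul, ← Finset.sum_sub_distrib]
      refine Finset.sum_congr rfl fun j _ => ?_
      by_cases hj : j ∈ F
      · simp only [hw, meanReward_of_mem hA c τ hF hj, ← hr]
        ring
      · simp [hμ.support j hj]
    rw [h1, ← hinv, hr, mul_div_cancel₀ _ (hτ F hF), sub_self]
  ext q
  have h2 : spectralProjector A *ᵥ w = spectralProjector A *ᵥ (spectralProjector A *ᵥ w) :=
    (spectralProjector_mulVec_of_invariant hA (mulVec_spectralProjector_mulVec hA w)).symm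
  rw [h2]
  refine Finset.sum_eq_zero fun j _ => ?_
  rcases (nonneg_of_mem_rowStochastic hB : 0 ≤ spectralProjector A q j).eq_or_lt with h0 | h0
  · exact mul_eq_zero_of_left h0.symm _
  · have hinv : (spectralProjector A q) ᵥ* A = spectralProjector A q := by
      conv_rhs => rw [← spectralProjector_mul hA]
      rfl
    obtain ⟨F, hF, hj⟩ := exists_finalClass_of_invariant hA
      (fun i => nonneg_of_mem_rowStochastic hB) hinv h0
    exact mul_eq_zero_of_right _ (hclass F hF j hj)

/-- The Poisson equation: a bias vector `u` goes with the mean reward `g`. -/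
theorem exists_bias (hA : A ∈ rowStochastic ℝ Q) (c τ : Q → ℝ)
    (hτ : ∀ F, IsFinalClass A F → invariantMeasure A F ⬝ᵥ τ ≠ 0) :
    ∃ u : Q → ℝ, ∀ q, u q = c q - τ q * meanReward A c τ q + (A *ᵥ u) q := by
  obtain ⟨u, hu⟩ := exists_eq_sub_of_spectralProjector_mulVec_eq_zero hA
    (spectralProjector_mulVec_sub_meanReward hA c τ hτ)
  refine ⟨u, fun q => ?_⟩
  have := congrFun hu q
  simp only [Pi.sub_apply] at this
  linarith

end Stochastic

/-! ### Discounted evaluation -/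

section Discounted

open Matrix

variable {Q : Type*} [Fintype Q] [DecidableEq Q] {A : Matrix Q Q ℝ} {c τ : Q → ℝ} {r : ℝ}

/-- The maximum principle for the discounted equation, the state `q` being discounted by
`1 - r τ_q`. A negative minimum of `x` would be attained on a closed set of states, on which `τ`
would vanish. -/
theorem nonneg_of_discounted_mulVec_le (hA : A ∈ rowStochastic ℝ Q) (hτ : ∀ q, 0 ≤ τ q)
    (hr : 0 < r) (hrτ : ∀ q, r * τ q ≤ 1)
    (hclosed : ∀ S : Set Q, S.Nonempty → (∀ i ∈ S, ∀ j, 0 < A i j → j ∈ S) → ∃ i ∈ S, 0 < τ i)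
    {x : Q → ℝ} (hx : ∀ q, (1 - r * τ q) * (A *ᵥ x) q ≤ x q) (q : Q) : 0 ≤ x q := by
  obtain ⟨q₀, -, hmin⟩ := Finset.univ.exists_min_image x ⟨q, Finset.mem_univ q⟩
  refine le_trans ?_ (hmin q (Finset.mem_univ q))
  by_contra! hneg
  have hlow : ∀ j, x q₀ ≤ x j := fun j => hmin j (Finset.mem_univ j)
  have hAx : ∀ i, x q₀ ≤ (A *ᵥ x) i := rowStochastic_le_mulVec hA hlow
  have key : ∀ i, x i = x q₀ → r * τ i = 0 := by
    intro i hi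
    have h1 := hx i
    rw [hi] at h1
    have h2 : (1 - r * τ i) * x q₀ ≤ (1 - r * τ i) * (A *ᵥ x) i :=
      mul_le_mul_of_nonneg_left (hAx i) (by linarith [hrτ i])
    have h3 : 0 ≤ r * τ i := mul_nonneg hr.le (hτ i)
    have h4 : 0 ≤ r * τ i * x q₀ := by linarith
    rcases h3.eq_or_lt with h | h
    · exact h.symm
    · exact absurd h4 (not_le.2 (mul_neg_of_pos_of_neg h hneg))
  obtain ⟨i, hi, hτi⟩ := hclosed {i | x i = x q₀} ⟨q₀, rfl⟩ fun i hi j hj => by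
    refine eq_of_mulVec_le hA (i := i) (fun k _ => hlow k) ?_ hj
    have h1 := hx i
    rwa [key i hi, sub_zero, one_mul, show x i = x q₀ from hi] at h1
  exact (mul_pos hr hτi).ne' (key i hi)

theorem exists_discounted_value (hA : A ∈ rowStochastic ℝ Q) (hτ : ∀ q, 0 ≤ τ q)
    (hr : 0 < r) (hrτ : ∀ q, r * τ q ≤ 1)
    (hclosed : ∀ S : Set Q, S.Nonempty → (∀ i ∈ S, ∀ j, 0 < A i j → j ∈ S) → ∃ i ∈ S, 0 < τ i)
    (c : Q → ℝ) : ∃ V : Q → ℝ, ∀ q, V q = c q + (1 - r * τ q) * (A *ᵥ V) q := by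
  set f : (Q → ℝ) →ₗ[ℝ] (Q → ℝ) :=
    (1 - Matrix.diagonal (fun q => 1 - r * τ q) * A).mulVecLin with hf
  have hfa : ∀ x q, f x q = x q - (1 - r * τ q) * (A *ᵥ x) q := fun x q => by
    rw [hf, mulVecLin_apply, sub_mulVec, ← mulVec_mulVec, Pi.sub_apply, mulVec_diagonal,
      one_mulVec]
  have hinj : Function.Injective f := by
    rw [injective_iff_map_eq_zero]
    intro x hx
    have h0 : ∀ q, x q - (1 - r * τ q) * (A *ᵥ x) q = 0 := fun q => by rw [← hfa, hx]; rfl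
    ext q
    have h1 := nonneg_of_discounted_mulVec_le hA hτ hr hrτ hclosed
      (x := x) (fun q => by linarith [h0 q]) q
    have h2 := nonneg_of_discounted_mulVec_le hA hτ hr hrτ hclosed
      (x := -x) (fun q => by simp only [mulVec_neg, Pi.neg_apply]; linarith [h0 q]) q
    simp only [Pi.neg_apply] at h2
    exact le_antisymm (neg_nonneg.1 h2) h1
  obtain ⟨V, hV⟩ := LinearMap.injective_iff_surjective.1 hinj c
  exact ⟨V, fun q => by rw [← hV, hfa]; ring⟩

section Expansion

variable {g u V : Q → ℝ} {K : ℝ}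

theorem mulVec_expansion (hA : A ∈ rowStochastic ℝ Q) (hg : A *ᵥ g = g) (k : ℝ) (q : Q) :
    (A *ᵥ fun q => g q / r + u q + k) q = g q / r + (A *ᵥ u) q + k := by
  have h1 : (fun q => g q / r + u q + k) = r⁻¹ • g + u + k • (1 : Q → ℝ) := by
    ext q
    simp [div_eq_inv_mul]
  rw [h1, mulVec_add, mulVec_add, mulVec_smul, mulVec_smul, hg, one_vecMul_of_mem_rowStochastic hA]
  simp [div_eq_inv_mul]

/-- A subsolution of the discounted equation is at most `g / r + O(1)`, where `g` is the mean
reward and `u` a bias. -/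
theorem discounted_le_expansion (hA : A ∈ rowStochastic ℝ Q) (hτ : ∀ q, 0 ≤ τ q)
    (hr : 0 < r) (hrτ : ∀ q, r * τ q ≤ 1)
    (hclosed : ∀ S : Set Q, S.Nonempty → (∀ i ∈ S, ∀ j, 0 < A i j → j ∈ S) → ∃ i ∈ S, 0 < τ i)
    (hg : A *ᵥ g = g) (hu : ∀ q, u q = c q - τ q * g q + (A *ᵥ u) q) (hK : ∀ q, |u q| ≤ K)
    (hV : ∀ q, V q ≤ c q + (1 - r * τ q) * (A *ᵥ V) q) (q : Q) :
    V q ≤ g q / r + u q + K := by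
  have h := nonneg_of_discounted_mulVec_le hA hτ hr hrτ hclosed
    (x := (fun q => g q / r + u q + K) - V) (fun q => ?_) q
  · simp only [Pi.sub_apply] at h
    linarith
  · rw [mulVec_sub, Pi.sub_apply, Pi.sub_apply, mulVec_expansion hA hg]
    have h1 : -K ≤ (A *ᵥ u) q := rowStochastic_le_mulVec hA (fun j => (abs_le.1 (hK j)).1) q
    have h2 : 0 ≤ r * τ q * ((A *ᵥ u) q + K) :=
      mul_nonneg (mul_nonneg hr.le (hτ q)) (by linarith)
    have h3 : r * τ q * (g q / r) = τ q * g q := by field_simp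
    linarith [hV q, hu q]

theorem expansion_le_discounted (hA : A ∈ rowStochastic ℝ Q) (hτ : ∀ q, 0 ≤ τ q)
    (hr : 0 < r) (hrτ : ∀ q, r * τ q ≤ 1)
    (hclosed : ∀ S : Set Q, S.Nonempty → (∀ i ∈ S, ∀ j, 0 < A i j → j ∈ S) → ∃ i ∈ S, 0 < τ i)
    (hg : A *ᵥ g = g) (hu : ∀ q, u q = c q - τ q * g q + (A *ᵥ u) q) (hK : ∀ q, |u q| ≤ K)
    (hV : ∀ q, c q + (1 - r * τ q) * (A *ᵥ V) q ≤ V q) (q : Q) :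
    g q / r + u q - K ≤ V q := by
  have h := discounted_le_expansion (c := -c) (g := -g) (u := -u) (V := -V) hA hτ hr hrτ hclosed
    (by rw [mulVec_neg, hg])
    (fun q => by simp only [mulVec_neg, Pi.neg_apply]; linarith [hu q])
    (fun q => by simpa using hK q)
    (fun q => by simp only [mulVec_neg, Pi.neg_apply]; linarith [hV q]) q
  simp only [Pi.neg_apply, neg_div] at h
  linarith

end Expansion

end Discounted

/-! ### The semi-Markov decision process of a Petri net -/

namespace FluidPetriNet

open Matrix

section Decision

variable {P Q : Type*} [Fintype P] [Fintype Q] {N : FluidPetriNet P Q} {e : Q → ℝ}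

variable (N) in
/-- The transition probability from `q` to `q'` when the upstream place `p` is selected. -/
noncomputable def kernel (e : Q → ℝ) (q : Q) (p : P) (q' : Q) : ℝ :=
  (e q)⁻¹ * (N.share q p * (N.inWeight q p)⁻¹ * N.outWeight p q') * e q'

variable (N) in
/-- The cost incurred in the state `q` when the upstream place `p` is selected. -/
noncomputable def placeCost (e : Q → ℝ) (m : P → ℝ) (q : Q) (p : P) : ℝ :=
  (e q)⁻¹ * (N.inWeight q p)⁻¹ * N.share q p * m p

theorem share_pos (he : N.IsStoichiometricInvariant e) (he_pos : ∀ q, 0 < e q) {q : Q} {p : P}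
    (hp : p ∈ N.upstream q) : 0 < N.share q p := by
  have h0 : 0 ≤ N.share q p := by
    rw [share]
    split_ifs with h
    · exact N.proportion_nonneg p h q hp
    · exact zero_le_one
  refine lt_of_le_of_ne h0 fun h => (he_pos q).ne' ?_
  rw [he q p hp, ← h, zero_mul, zero_mul]

theorem kernel_nonneg (he : N.IsStoichiometricInvariant e) (he_pos : ∀ q, 0 < e q) {q : Q} {p : P}
    (hp : p ∈ N.upstream q) (q' : Q) : 0 ≤ N.kernel e q p q' := by
  have h1 := share_pos he he_pos hp
  have h2 : 0 < N.inWeight q p := hp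
  have h3 := N.outWeight_nonneg p q'
  have h4 := he_pos q
  have h5 := he_pos q'
  rw [kernel]
  positivity

theorem kernel_sum (he : N.IsStoichiometricInvariant e) (he_pos : ∀ q, 0 < e q) {q : Q} {p : P}
    (hp : p ∈ N.upstream q) : ∑ q', N.kernel e q p q' = 1 := by
  have h : ∑ q', N.kernel e q p q' =
      (e q)⁻¹ * (N.share q p * (N.inWeight q p)⁻¹ * ∑ q', N.outWeight p q' * e q') := by
    rw [Finset.mul_sum, Finset.mul_sum]
    exact Finset.sum_congr rfl fun q' _ => by rw [kernel]; ring
  rw [h, ← he q p hp, inv_mul_cancel₀ (he_pos q).ne']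

theorem outWeight_pos_of_kernel_pos {q : Q} {p : P} {q' : Q} (h : 0 < N.kernel e q p q') :
    0 < N.outWeight p q' := by
  refine lt_of_le_of_ne (N.outWeight_nonneg p q') fun h0 => ?_
  rw [kernel, ← h0] at h
  simp at h

theorem placeCost_nonneg (he : N.IsStoichiometricInvariant e) (he_pos : ∀ q, 0 < e q)
    {m : P → ℝ} (hm : m ∈ markings P) {q : Q} {p : P} (hp : p ∈ N.upstream q) :
    0 ≤ N.placeCost e m q p := by
  have h1 := share_pos he he_pos hp
  have h2 : 0 < N.inWeight q p := hp
  have h3 : 0 ≤ m p := hm p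
  have h4 := he_pos q
  rw [placeCost]
  positivity

theorem policyMatrix_mem_rowStochastic [DecidableEq Q] (he : N.IsStoichiometricInvariant e)
    (he_pos : ∀ q, 0 < e q) (σ : N.Policy) : policyMatrix e σ ∈ rowStochastic ℝ Q :=
  mem_rowStochastic_iff_sum.2 ⟨fun q q' => kernel_nonneg he he_pos (σ.2 q) q',
    fun q => kernel_sum he he_pos (σ.2 q)⟩

theorem wellFounded_zeroHolding (hN : N.NonZeno) : WellFounded (Relation.TransGen
    fun q' q => ∃ p, 0 < N.outWeight p q' ∧ 0 < N.inWeight q p ∧ N.holding p = 0) := by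
  have : Std.Irrefl (Relation.TransGen
    fun q' q => ∃ p, 0 < N.outWeight p q' ∧ 0 < N.inWeight q p ∧ N.holding p = 0) := ⟨hN⟩
  exact Finite.wellFounded_of_trans_of_irrefl _

/-- A policy has no closed set of transitions with zero holding times, as it would contain
a circuit. -/
theorem exists_policyTime_pos (hN : N.NonZeno) (he : N.IsStoichiometricInvariant e)
    (he_pos : ∀ q, 0 < e q) (σ : N.Policy) (S : Set Q) (hS : S.Nonempty)
    (hclosed : ∀ i ∈ S, ∀ j, 0 < policyMatrix e σ i j → j ∈ S) :
    ∃ i ∈ S, 0 < policyTime σ i := by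
  obtain ⟨i, hi, hmin⟩ := (wellFounded_zeroHolding hN).has_min S hS
  refine ⟨i, hi, lt_of_le_of_ne (N.holding_nonneg _) fun h0 => ?_⟩
  obtain ⟨j, -, hj⟩ := Finset.exists_ne_zero_of_sum_ne_zero
    ((kernel_sum he he_pos (σ.2 i)).trans_ne one_ne_zero)
  have hij : 0 < policyMatrix e σ i j :=
    lt_of_le_of_ne (kernel_nonneg he he_pos (σ.2 i) j) hj.symm
  exact hmin j (hclosed i hi j hij) (Relation.TransGen.single
    ⟨σ.1 i, outWeight_pos_of_kernel_pos hij, σ.2 i, h0.symm⟩)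

theorem invariantMeasure_dotProduct_policyTime_pos [DecidableEq Q] (hN : N.NonZeno)
    (he : N.IsStoichiometricInvariant e) (he_pos : ∀ q, 0 < e q) (σ : N.Policy) {F : Finset Q}
    (hF : IsFinalClass (policyMatrix e σ) F) :
    0 < invariantMeasure (policyMatrix e σ) F ⬝ᵥ policyTime σ := by
  have hA := policyMatrix_mem_rowStochastic he he_pos σ
  have hμ := (isInvariantMeasureOn_iff hA hF _).2 rfl
  set μ := invariantMeasure (policyMatrix e σ) F
  obtain ⟨i₀, -, hi₀⟩ := Finset.exists_ne_zero_of_sum_ne_zero (hμ.sum_one.trans_ne one_ne_zero)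
  -- the support of an invariant measure is closed
  obtain ⟨i, hi, hτ⟩ := exists_policyTime_pos hN he he_pos σ {i | 0 < μ i}
    ⟨i₀, lt_of_le_of_ne (hμ.nonneg i₀) hi₀.symm⟩ fun i hi j hij => by
      rw [mem_ofPred_eq, ← hμ.invariant j]
      exact Finset.sum_pos' (fun k _ => mul_nonneg (hμ.nonneg k) (nonneg_of_mem_rowStochastic hA))
        ⟨i, Finset.mem_univ i, mul_pos hi hij⟩
  exact Finset.sum_pos' (fun k _ => mul_nonneg (hμ.nonneg k) (N.holding_nonneg _))
    ⟨i, Finset.mem_univ i, mul_pos hi hτ⟩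

instance : Finite N.Policy := by
  unfold Policy
  infer_instance

instance : Nonempty N.Policy :=
  ⟨⟨fun q => (N.exists_upstream q).choose, fun q => (N.exists_upstream q).choose_spec⟩⟩

end Decision

section Optimality

variable {P Q : Type*} [Fintype P] [Fintype Q] [DecidableEq Q] {N : FluidPetriNet P Q} {e : Q → ℝ}

/-- The discounted Bellman equation has a solution. Among all policies, the one with the least
total value solves it: otherwise selecting the best place everywhere would improve it. -/
theorem exists_discounted_optimal (hN : N.NonZeno) (he : N.IsStoichiometricInvariant e)
    (he_pos : ∀ q, 0 < e q) (m : P → ℝ) {r : ℝ} (hr : 0 < r) (hrτ : ∀ p, r * N.holding p ≤ 1) :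
    ∃ (σ : N.Policy) (V : Q → ℝ),
      (∀ q, V q = policyCost e σ m q + (1 - r * policyTime σ q) * (policyMatrix e σ *ᵥ V) q) ∧
      ∀ q, ∀ p ∈ N.upstream q,
        V q ≤ N.placeCost e m q p + (1 - r * N.holding p) * ∑ q', N.kernel e q p q' * V q' := by
  have hA := fun σ : N.Policy => policyMatrix_mem_rowStochastic he he_pos σ
  have hcl := fun σ : N.Policy => exists_policyTime_pos hN he he_pos σ
  choose V hV using fun σ : N.Policy => exists_discounted_value (hA σ)
    (fun q => N.holding_nonneg _) hr (fun q => hrτ (σ.1 q)) (hcl σ) (policyCost e σ m)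
  obtain ⟨σ, hσ⟩ := Finite.exists_min fun σ : N.Policy => ∑ q, V σ q
  refine ⟨σ, V σ, hV σ, ?_⟩
  set B : Q → P → ℝ := fun q p =>
    N.placeCost e m q p + (1 - r * N.holding p) * ∑ q', N.kernel e q p q' * V σ q' with hB
  have hbest : ∀ q, ∃ p ∈ N.upstream q, ∀ p' ∈ N.upstream q, B q p ≤ B q p' := fun q =>
    exists_min_image _ (B q) (toFinite _) (N.exists_upstream q)
  choose s hs hsmin using hbest
  let σ' : N.Policy := ⟨s, hs⟩
  have hVB : ∀ q, V σ q = B q (σ.1 q) := fun q => hV σ q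
  have hle : ∀ q, V σ' q ≤ V σ q := by
    intro q
    have h := nonneg_of_discounted_mulVec_le (hA σ') (τ := policyTime σ')
      (fun q => N.holding_nonneg _) hr (fun q => hrτ _) (hcl σ') (x := V σ - V σ') (fun q => ?_) q
    · simpa using h
    · have h1 : B q (s q) ≤ V σ q := (hsmin q _ (σ.2 q)).trans (hVB q).ge
      have h2 : B q (s q) = policyCost e σ' m q +
          (1 - r * policyTime σ' q) * (policyMatrix e σ' *ᵥ V σ) q := rfl
      have h3 : V σ' q = policyCost e σ' m q +
          (1 - r * policyTime σ' q) * (policyMatrix e σ' *ᵥ V σ') q := hV σ' q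
      rw [mulVec_sub, Pi.sub_apply, Pi.sub_apply, mul_sub]
      linarith
  have heq : ∀ q, V σ' q = V σ q := fun q =>
    (Finset.sum_eq_sum_iff_of_le fun q _ => hle q).1
      (le_antisymm (Finset.sum_le_sum fun q _ => hle q) (hσ σ')) q (Finset.mem_univ q)
  intro q p hp
  have h1 : B q (s q) = V σ q := by
    rw [← heq, hV σ' q, funext heq]
    rfl
  rw [← h1]
  exact hsmin q p hp

/-- The average-cost optimality equations: some policy `σ` minimizes the value in every state, and
its value `g` together with some bias `u` solves the lexicographic Bellman equations. They are
obtained from the discounted equations along a sequence of discount rates `r → 0` for which the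
same policy is optimal and the vectors `V_r - g / r` converge, to `u`. -/
theorem exists_optimal_policy (hN : N.NonZeno) (he : N.IsStoichiometricInvariant e)
    (he_pos : ∀ q, 0 < e q) (m : P → ℝ) :
    ∃ (σ : N.Policy) (u : Q → ℝ),
      (∀ σ' : N.Policy, ∀ q, policyValue e σ m q ≤ policyValue e σ' m q) ∧
      (∀ q, policyValue e σ m q = ∑ q', N.kernel e q (σ.1 q) q' * policyValue e σ m q') ∧
      (∀ q, u q = N.placeCost e m q (σ.1 q) - N.holding (σ.1 q) * policyValue e σ m q +
        ∑ q', N.kernel e q (σ.1 q) q' * u q') ∧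
      ∀ q, ∀ p ∈ N.upstream q,
        policyValue e σ m q ≤ ∑ q', N.kernel e q p q' * policyValue e σ m q' ∧
        (policyValue e σ m q = ∑ q', N.kernel e q p q' * policyValue e σ m q' →
          u q ≤ N.placeCost e m q p - N.holding p * policyValue e σ m q +
            ∑ q', N.kernel e q p q' * u q') := by
  have hA := fun σ : N.Policy => policyMatrix_mem_rowStochastic he he_pos σ
  have hcl := fun σ : N.Policy => exists_policyTime_pos hN he he_pos σ
  have hτF := fun (σ : N.Policy) F hF =>
    (invariantMeasure_dotProduct_policyTime_pos (e := e) hN he he_pos σ (F := F) hF).ne'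
  -- discount rates tending to zero
  obtain ⟨T, hT⟩ : ∃ T : ℝ, ∀ p, N.holding p ≤ T :=
    ⟨∑ p, N.holding p, fun p =>
      Finset.single_le_sum (fun p _ => N.holding_nonneg p) (Finset.mem_univ p)⟩
  set r : ℕ → ℝ := fun n => 1 / (|T| + 1) * (1 / ((n : ℝ) + 1)) with hrdef
  have hT0 : 0 < |T| + 1 := by positivity
  have hr : ∀ n, 0 < r n := fun n => by simp only [hrdef]; positivity
  have hrlim : Tendsto r atTop (𝓝 0) := by
    have h := (tendsto_one_div_add_atTop_nhds_zero_nat (𝕜 := ℝ)).const_mul (1 / (|T| + 1))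
    rwa [mul_zero] at h
  have hrτ : ∀ n p, r n * N.holding p ≤ 1 := by
    intro n p
    have h1 : r n ≤ 1 / (|T| + 1) := by
      refine mul_le_of_le_one_right (by positivity) ?_
      rw [div_le_one (by positivity)]
      linarith [Nat.cast_nonneg (α := ℝ) n]
    calc r n * N.holding p ≤ 1 / (|T| + 1) * (|T| + 1) :=
          mul_le_mul h1 (by linarith [hT p, le_abs_self T]) (N.holding_nonneg p) (by positivity)
      _ = 1 := by field_simp
  choose s V hV hVle using fun n => exists_discounted_optimal hN he he_pos m (hr n) (hrτ n)
  obtain ⟨σ, hσ⟩ : ∃ σ, ∃ᶠ n in atTop, s n = σ := by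
    by_contra! h
    obtain ⟨n, hn⟩ := (eventually_all.2 h).exists
    exact hn (s n) rfl
  obtain ⟨φ, hφ, hsφ⟩ := extraction_of_frequently_atTop hσ
  set g := policyValue e σ m with hgdef
  have hg : policyMatrix e σ *ᵥ g = g := mulVec_meanReward (hA σ) _ _
  obtain ⟨u₀, hu₀⟩ := exists_bias (hA σ) (policyCost e σ m) (policyTime σ) (hτF σ)
  set K := ‖u₀‖
  have hK : ∀ q, |u₀ q| ≤ K := fun q => norm_le_pi_norm u₀ q
  have hVσ : ∀ n q, V (φ n) q = policyCost e σ m q +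
      (1 - r (φ n) * policyTime σ q) * (policyMatrix e σ *ᵥ V (φ n)) q := fun n q => by
    have := hV (φ n) q
    rwa [hsφ n] at this
  -- the deviations from the leading terms are bounded
  set y : ℕ → Q → ℝ := fun n q => V (φ n) q - g q / r (φ n) with hy
  have hyb : ∀ n, y n ∈ Metric.closedBall (0 : Q → ℝ) (2 * K) := by
    intro n
    rw [mem_closedBall_zero_iff, pi_norm_le_iff_of_nonneg (by positivity)]
    intro q
    have h1 := discounted_le_expansion (hA σ) (fun q => N.holding_nonneg _) (hr (φ n))
      (fun q => hrτ (φ n) _) (hcl σ) hg hu₀ hK (fun q => (hVσ n q).le) q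
    have h2 := expansion_le_discounted (hA σ) (fun q => N.holding_nonneg _) (hr (φ n))
      (fun q => hrτ (φ n) _) (hcl σ) hg hu₀ hK (fun q => (hVσ n q).ge) q
    have h3 := abs_le.1 (hK q)
    rw [Real.norm_eq_abs, abs_le]
    simp only [hy]
    constructor <;> linarith
  obtain ⟨u, -, ψ, hψ, hulim⟩ := tendsto_subseq_of_bounded Metric.isBounded_closedBall hyb
  have hu : ∀ q, Tendsto (fun n => y (ψ n) q) atTop (𝓝 (u q)) := fun q =>
    (tendsto_pi_nhds.1 hulim) q
  have hρ : Tendsto (fun n => r (φ (ψ n))) atTop (𝓝 0) :=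
    hrlim.comp (hφ.tendsto_atTop.comp hψ.tendsto_atTop)
  have hVy : ∀ n q, V (φ n) q = g q / r (φ n) + y n q := fun n q => by simp [hy]
  -- the discounted right-hand side, in terms of the deviations
  have hrhs : ∀ n q p, N.placeCost e m q p + (1 - r (φ n) * N.holding p) *
      ∑ q', N.kernel e q p q' * V (φ n) q' =
      (∑ q', N.kernel e q p q' * g q') / r (φ n) + (N.placeCost e m q p -
        N.holding p * ∑ q', N.kernel e q p q' * g q' +
        (1 - r (φ n) * N.holding p) * ∑ q', N.kernel e q p q' * y n q') := by
    intro n q p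
    have h1 : ∑ q', N.kernel e q p q' * V (φ n) q' =
        (∑ q', N.kernel e q p q' * g q') / r (φ n) + ∑ q', N.kernel e q p q' * y n q' := by
      rw [Finset.sum_div, ← Finset.sum_add_distrib]
      exact Finset.sum_congr rfl fun q' _ => by rw [hVy]; ring
    rw [h1]
    have := (hr (φ n)).ne'
    field_simp
    ring
  have hrhslim : ∀ q p, Tendsto (fun n => N.placeCost e m q p -
      N.holding p * ∑ q', N.kernel e q p q' * g q' +
        (1 - r (φ (ψ n)) * N.holding p) * ∑ q', N.kernel e q p q' * y (ψ n) q') atTop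
      (𝓝 (N.placeCost e m q p - N.holding p * ∑ q', N.kernel e q p q' * g q' +
        ∑ q', N.kernel e q p q' * u q')) := by
    intro q p
    have h1 : Tendsto (fun n => 1 - r (φ (ψ n)) * N.holding p) atTop (𝓝 1) := by
      simpa using (hρ.mul_const (N.holding p)).const_sub 1
    have h2 : Tendsto (fun n => ∑ q', N.kernel e q p q' * y (ψ n) q') atTop
        (𝓝 (∑ q', N.kernel e q p q' * u q')) :=
      tendsto_finsetSum _ fun q' _ => (hu q').const_mul _
    simpa using (h1.mul h2).const_add
      (N.placeCost e m q p - N.holding p * ∑ q', N.kernel e q p q' * g q')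
  -- comparing the leading terms in an inequality between expansions
  have hlead : ∀ {a b : ℝ} {x z : ℕ → ℝ} {x₀ z₀ : ℝ}, Tendsto x atTop (𝓝 x₀) →
      Tendsto z atTop (𝓝 z₀) →
      (∀ n, a / r (φ (ψ n)) + x n ≤ b / r (φ (ψ n)) + z n) → a ≤ b := by
    intro a b x z x₀ z₀ hx hz h
    have h1 : Tendsto (fun n => a + r (φ (ψ n)) * x n) atTop (𝓝 a) := by
      simpa using (hρ.mul hx).const_add a
    have h2 : Tendsto (fun n => b + r (φ (ψ n)) * z n) atTop (𝓝 b) := by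
      simpa using (hρ.mul hz).const_add b
    refine le_of_tendsto_of_tendsto' h1 h2 fun n => ?_
    have h3 := mul_le_mul_of_nonneg_left (h n) (hr (φ (ψ n))).le
    have h4 := (hr (φ (ψ n))).ne'
    rwa [mul_add, mul_add, mul_div_cancel₀ _ h4, mul_div_cancel₀ _ h4] at h3
  have hgσ : ∀ q, g q = ∑ q', N.kernel e q (σ.1 q) q' * g q' := fun q => (congrFun hg q).symm
  refine ⟨σ, u, ?_, hgσ, ?_, ?_⟩
  · intro σ' q
    obtain ⟨u', hu'⟩ := exists_bias (hA σ') (policyCost e σ' m) (policyTime σ') (hτF σ')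
    refine hlead (x := fun n => y (ψ n) q) (z := fun _ => u' q + ‖u'‖) (hu q)
      tendsto_const_nhds fun n => ?_
    rw [← hVy, ← add_assoc]
    exact discounted_le_expansion (hA σ') (fun q => N.holding_nonneg _) (hr _)
      (fun q => hrτ _ _) (hcl σ') (mulVec_meanReward (hA σ') _ _) hu'
      (fun q => norm_le_pi_norm u' q) (fun q => hVle _ q _ (σ'.2 q)) q
  · intro q
    have h := hrhslim q (σ.1 q)
    rw [← hgσ q] at h
    refine tendsto_nhds_unique (hu q) (h.congr fun n => ?_)
    have h1 := (hVσ (ψ n) q).trans (hrhs (ψ n) q (σ.1 q))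
    rw [hVy, ← hgσ q] at h1
    exact (add_left_cancel h1).symm
  · intro q p hp
    have hle : ∀ n, g q / r (φ (ψ n)) + y (ψ n) q ≤
        (∑ q', N.kernel e q p q' * g q') / r (φ (ψ n)) + (N.placeCost e m q p -
          N.holding p * ∑ q', N.kernel e q p q' * g q' +
          (1 - r (φ (ψ n)) * N.holding p) * ∑ q', N.kernel e q p q' * y (ψ n) q') := fun n =>
      (hVy (ψ n) q).symm.le.trans ((hVle (φ (ψ n)) q p hp).trans (hrhs (ψ n) q p).le)
    refine ⟨hlead (hu q) (hrhslim q p) hle, fun hgp => ?_⟩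
    have h := hrhslim q p
    rw [← hgp] at h
    refine le_of_tendsto_of_tendsto' (hu q) h fun n => ?_
    have h1 := hle n
    rw [← hgp] at h1
    exact le_of_add_le_add_left h1

end Optimality

end FluidPetriNet

/-! ### The dynamics -/

namespace FluidPetriNet

section Dynamics

variable {P Q : Type*} [Fintype P] [Fintype Q] {N : FluidPetriNet P Q} {e : Q → ℝ} {m : P → ℝ}

variable (N) in
/-- The event `(t', q')` is used in the computation of the event `(t, q)`, for `t > s`. -/
def Precedes (s : ℝ) (x' x : ℝ × Q) : Prop :=
  s < x.1 ∧ ∃ p, 0 < N.outWeight p x'.2 ∧ 0 < N.inWeight x.2 p ∧ x'.1 = x.1 - N.holding p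

theorem exists_holding_lower_bound : ∃ δ > 0, ∀ p, N.holding p = 0 ∨ δ ≤ N.holding p := by
  rcases {p | 0 < N.holding p}.eq_empty_or_nonempty with h | h
  · refine ⟨1, one_pos, fun p => Or.inl (le_antisymm ?_ (N.holding_nonneg p))⟩
    by_contra! hp
    exact (h ▸ hp : p ∈ (∅ : Set P))
  · obtain ⟨p₀, hp₀, hmin⟩ := exists_min_image _ N.holding (toFinite _) h
    refine ⟨N.holding p₀, hp₀, fun p => ?_⟩
    rcases (N.holding_nonneg p).eq_or_lt with h | h
    · exact Or.inl h.symm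
    · exact Or.inr (hmin p h)

/-- Lexicographic descent: a positive holding time decreases the number of steps needed to go
back to time `s`, and the non-Zeno condition orders the events that occur at the same time. -/
theorem wellFounded_precedes (hN : N.NonZeno) (s : ℝ) : WellFounded (N.Precedes s) := by
  obtain ⟨δ, hδ, hδp⟩ := N.exists_holding_lower_bound
  refine Subrelation.wf ?_ (InvImage.wf (fun x : ℝ × Q => (⌈(x.1 - s) / δ⌉₊, x.2))
    (WellFounded.prod_lex Nat.lt_wfRel.wf (wellFounded_zeroHolding hN)))
  rintro ⟨t', q'⟩ ⟨t, q⟩ ⟨hst, p, hout, hin, ht'⟩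
  simp only at hst hout hin ht'
  subst ht'
  rcases hδp p with h0 | hp
  · simp only [InvImage, h0, sub_zero]
    exact Prod.Lex.right _ (Relation.TransGen.single ⟨p, hout, hin, h0⟩)
  · refine Prod.Lex.left _ _ ?_
    have hpos : 0 < (t - s) / δ := div_pos (by linarith) hδ
    have hc : 1 ≤ ⌈(t - s) / δ⌉₊ := Nat.ceil_pos.2 hpos
    have hle : ⌈(t - N.holding p - s) / δ⌉₊ ≤ ⌈(t - s) / δ⌉₊ - 1 := by
      rw [Nat.ceil_le, Nat.cast_sub hc, Nat.cast_one]
      have h1 : (t - N.holding p - s) / δ ≤ (t - s) / δ - 1 := by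
        rw [div_sub_one hδ.ne']
        exact div_le_div_of_nonneg_right (by linarith) hδ.le
      linarith [Nat.le_ceil ((t - s) / δ)]
    exact lt_of_le_of_lt hle (Nat.sub_lt hc one_pos)

theorem holding_le_maxHolding (p : P) : N.holding p ≤ N.maxHolding :=
  le_ciSup (finite_range N.holding).bddAbove p

theorem maxHolding_nonneg : 0 ≤ N.maxHolding := Real.iSup_nonneg N.holding_nonneg

/-- Induction along the dynamics, from a time window of the length of the largest holding time. -/
theorem time_induction (hN : N.NonZeno) {s : ℝ} {Φ : ℝ → Q → Prop}
    (base : ∀ t ∈ Icc (s - N.maxHolding) s, ∀ q, Φ t q)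
    (step : ∀ t, s < t → ∀ q, (∀ p ∈ N.upstream q, ∀ q', 0 < N.outWeight p q' →
      Φ (t - N.holding p) q') → Φ t q)
    {t : ℝ} (ht : s - N.maxHolding ≤ t) (q : Q) : Φ t q := by
  suffices h : ∀ x : ℝ × Q, s - N.maxHolding ≤ x.1 → Φ x.1 x.2 from h (t, q) ht
  intro x
  induction x using (wellFounded_precedes hN s).induction with
  | _ x ih =>
    intro hx
    rcases le_or_gt x.1 s with hxs | hxs
    · exact base _ ⟨hx, hxs⟩ _
    · refine step _ hxs _ fun p hp q' hq' => ih (x.1 - N.holding p, q') ⟨hxs, p, hq', hp, rfl⟩ ?_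
      simp only
      linarith [N.holding_le_maxHolding p]

/-- The dynamics determines the counters from their values at nonpositive times, here zero. -/
theorem exists_isTrajectory (hN : N.NonZeno) (m : P → ℝ) : ∃ z, N.IsTrajectory m z := by
  classical
  let F : (x : ℝ × Q) → (∀ y, N.Precedes 0 y x → ℝ) → ℝ := fun x ih =>
    if hx : 0 < x.1 then ⨅ p : N.upstream x.2, N.share x.2 p * (N.inWeight x.2 p)⁻¹ *
      (m p + ∑ q', if h : 0 < N.outWeight p q' then
        N.outWeight p q' * ih (x.1 - N.holding p, q') ⟨hx, p, h, p.2, rfl⟩ else 0)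
    else 0
  let z : ℝ → Q → ℝ := fun t q => (wellFounded_precedes hN 0).fix F (t, q)
  have hz0 : ∀ t ≤ 0, ∀ q, z t q = 0 := fun t ht q => by
    simp only [z]
    rw [WellFounded.fix_eq]
    exact dif_neg (not_lt.2 ht)
  have hz : ∀ t, 0 < t → ∀ q, z t q = ⨅ p : N.upstream q, N.share q p * (N.inWeight q p)⁻¹ *
      (m p + ∑ q', N.outWeight p q' * z (t - N.holding p) q') := fun t ht q => by
    simp only [z]
    rw [WellFounded.fix_eq]
    refine (dif_pos ht).trans (iInf_congr fun p => ?_)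
    congr 2
    refine Finset.sum_congr rfl fun q' _ => ?_
    split_ifs with h
    · rfl
    · rw [le_antisymm (not_lt.1 h) (N.outWeight_nonneg _ _), zero_mul]
  refine ⟨z, ⟨0, fun t ht q => by rw [hz0 t ht.2 q, abs_zero]⟩, fun t ht q => ?_⟩
  rw [hz t ht q]
  have : Nonempty (N.upstream q) := ⟨⟨_, (N.exists_upstream q).choose_spec⟩⟩
  obtain ⟨p, hp⟩ := exists_eq_ciInf_of_finite (f := fun p : N.upstream q =>
    N.share q p * (N.inWeight q p)⁻¹ *
      (m p + ∑ q', N.outWeight p q' * z (t - N.holding p) q'))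
  refine ⟨⟨p, p.2, hp⟩, ?_⟩
  rintro _ ⟨p', hp', rfl⟩
  exact ciInf_le (finite_range _).bddBelow (⟨p', hp'⟩ : N.upstream q)

/-- The dynamics for the counters normalized by the stoichiometric invariant. -/
theorem place_term_eq (he_pos : ∀ q, 0 < e q) (y : Q → ℝ) (q : Q) (p : P) :
    N.share q p * (N.inWeight q p)⁻¹ * (m p + ∑ q', N.outWeight p q' * y q') =
      e q * (N.placeCost e m q p + ∑ q', N.kernel e q p q' * (y q' / e q')) := by
  have h : ∀ q', N.kernel e q p q' * (y q' / e q') =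
      (e q)⁻¹ * (N.share q p * (N.inWeight q p)⁻¹ * (N.outWeight p q' * y q')) := fun q' => by
    have := (he_pos q').ne'
    rw [kernel]
    field_simp
  simp only [h, ← Finset.mul_sum, placeCost]
  have := (he_pos q).ne'
  field_simp

theorem kernel_sum_mono (he : N.IsStoichiometricInvariant e) (he_pos : ∀ q, 0 < e q) {q : Q}
    {p : P} (hp : p ∈ N.upstream q) {x y : Q → ℝ}
    (h : ∀ q', 0 < N.outWeight p q' → x q' ≤ y q') :
    ∑ q', N.kernel e q p q' * x q' ≤ ∑ q', N.kernel e q p q' * y q' := by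
  refine Finset.sum_le_sum fun q' _ => ?_
  rcases (kernel_nonneg he he_pos hp q').eq_or_lt with h0 | h0
  · simp [← h0]
  · exact mul_le_mul_of_nonneg_left (h q' (outWeight_pos_of_kernel_pos h0)) h0.le

theorem kernel_sum_add_const (he : N.IsStoichiometricInvariant e) (he_pos : ∀ q, 0 < e q) {q : Q}
    {p : P} (hp : p ∈ N.upstream q) (x : Q → ℝ) (C : ℝ) :
    ∑ q', N.kernel e q p q' * (x q' + C) = ∑ q', N.kernel e q p q' * x q' + C := by
  simp only [mul_add, Finset.sum_add_distrib, ← Finset.sum_mul, kernel_sum he he_pos hp, one_mul]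

theorem kernel_sum_line (g u : Q → ℝ) (q : Q) (p : P) (t : ℝ) :
    ∑ q', N.kernel e q p q' * (g q' * t + u q') =
      (∑ q', N.kernel e q p q' * g q') * t + ∑ q', N.kernel e q p q' * u q' := by
  rw [Finset.sum_mul, ← Finset.sum_add_distrib]
  exact Finset.sum_congr rfl fun q' _ => by ring

theorem exists_abs_line_le (g u : Q → ℝ) (a b : ℝ) :
    ∃ C, ∀ t ∈ Icc a b, ∀ q, |g q * t + u q| ≤ C := by
  have h : ∀ q, ∃ C, ∀ t ∈ Icc a b, |g q * t + u q| ≤ C := fun q => by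
    obtain ⟨C, hC⟩ := isCompact_Icc.exists_bound_of_continuousOn (s := Icc a b)
      (f := fun t => g q * t + u q) (by fun_prop)
    exact ⟨C, hC⟩
  choose C hC using h
  obtain ⟨M, hM⟩ := Finite.exists_le C
  exact ⟨M, fun t ht q => (hC q t ht).trans (hM q)⟩

variable {z : ℝ → Q → ℝ}

theorem IsTrajectory.exists_normalized_bound (hz : N.IsTrajectory m z) (he_pos : ∀ q, 0 < e q) :
    ∃ C, 0 ≤ C ∧ ∀ t ∈ Icc (-N.maxHolding) 0, ∀ q, |z t q / e q| ≤ C := by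
  obtain ⟨C, hC⟩ := hz.initial_bounded
  obtain ⟨M, hM⟩ := Finite.exists_le fun q => C / e q
  refine ⟨max M 0, le_max_right _ _, fun t ht q => ?_⟩
  rw [abs_div, abs_of_pos (he_pos q)]
  exact (div_le_div_of_nonneg_right (hC t ht q) (he_pos q).le).trans
    ((hM q).trans (le_max_left _ _))

/-- The half-line `g t + u` solves the dynamics of a fixed policy, and the counters remain below
it, up to a constant. -/
theorem IsTrajectory.exists_le_line (hz : N.IsTrajectory m z) (hN : N.NonZeno)
    (he : N.IsStoichiometricInvariant e) (he_pos : ∀ q, 0 < e q) (σ : N.Policy) {g u : Q → ℝ}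
    (hg : ∀ q, g q = ∑ q', N.kernel e q (σ.1 q) q' * g q')
    (hu : ∀ q, u q = N.placeCost e m q (σ.1 q) - N.holding (σ.1 q) * g q +
      ∑ q', N.kernel e q (σ.1 q) q' * u q') :
    ∃ C, ∀ t, 0 ≤ t → ∀ q, z t q / e q ≤ g q * t + u q + C := by
  obtain ⟨C₁, -, hC₁⟩ := hz.exists_normalized_bound he_pos
  obtain ⟨C₂, hC₂⟩ := exists_abs_line_le g u (-N.maxHolding) 0
  refine ⟨C₁ + C₂, fun t ht q => ?_⟩
  refine time_induction hN (s := 0) (Φ := fun t q => z t q / e q ≤ g q * t + u q + (C₁ + C₂))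
    ?_ ?_ (by linarith [N.maxHolding_nonneg]) q
  · intro t ht q
    rw [zero_sub] at ht
    linarith [(abs_le.1 (hC₁ t ht q)).2, (abs_le.1 (hC₂ t ht q)).1]
  · intro t ht q ih
    have h1 := (hz.dynamics t ht q).2 ⟨σ.1 q, σ.2 q, rfl⟩
    simp only [place_term_eq he_pos (z (t - N.holding (σ.1 q)))] at h1
    have h2 := kernel_sum_mono he he_pos (σ.2 q) (ih _ (σ.2 q))
    rw [kernel_sum_add_const he he_pos (σ.2 q), kernel_sum_line, ← hg q] at h2
    rw [div_le_iff₀' (he_pos q)]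
    refine h1.trans (mul_le_mul_of_nonneg_left ?_ (he_pos q).le)
    linarith [hu q]

/-- The half-line `g t + u` is eventually below its image by the dynamics, and the counters remain
above it, up to a constant. -/
theorem IsTrajectory.exists_line_le (hz : N.IsTrajectory m z) (hN : N.NonZeno)
    (he : N.IsStoichiometricInvariant e) (he_pos : ∀ q, 0 < e q) (hm : m ∈ markings P)
    {g u : Q → ℝ}
    (hg : ∀ q, ∀ p ∈ N.upstream q, g q ≤ ∑ q', N.kernel e q p q' * g q')
    (hu : ∀ q, ∀ p ∈ N.upstream q, g q = ∑ q', N.kernel e q p q' * g q' →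
      u q ≤ N.placeCost e m q p - N.holding p * g q + ∑ q', N.kernel e q p q' * u q') :
    ∃ C t₀, ∀ t, t₀ ≤ t → ∀ q, g q * t + u q - C ≤ z t q / e q := by
  obtain ⟨C₁, hC₁0, hC₁⟩ := hz.exists_normalized_bound he_pos
  -- costs are nonnegative, so that lower bounds on the initial condition propagate
  have hlow : ∀ t, -N.maxHolding ≤ t → ∀ q, -C₁ ≤ z t q / e q := by
    intro t ht q
    refine time_induction hN (s := 0) (Φ := fun t q => -C₁ ≤ z t q / e q) ?_ ?_
      (by linarith) q
    · intro t ht q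
      rw [zero_sub] at ht
      exact (abs_le.1 (hC₁ t ht q)).1
    · intro t ht q ih
      obtain ⟨p, hp, hpz⟩ := (hz.dynamics t ht q).1
      simp only [place_term_eq he_pos (z (t - N.holding p))] at hpz
      have h2 := kernel_sum_mono he he_pos hp (x := fun _ => -C₁) (ih p hp)
      rw [← Finset.sum_mul, kernel_sum he he_pos hp, one_mul] at h2
      rw [← hpz, mul_div_cancel_left₀ _ (he_pos q).ne']
      linarith [placeCost_nonneg he he_pos hm hp]
  have hev : ∀ᶠ t : ℝ in atTop, ∀ q, ∀ p ∈ N.upstream q, g q * t + u q ≤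
      N.placeCost e m q p + ∑ q', N.kernel e q p q' * (g q' * (t - N.holding p) + u q') := by
    simp only [kernel_sum_line]
    refine eventually_all.2 fun q => eventually_all.2 fun p => ?_
    by_cases hp : p ∈ N.upstream q
    · rcases (hg q p hp).eq_or_lt with h | h
      · refine Eventually.of_forall fun t _ => ?_
        have := hu q p hp h
        rw [← h]
        linarith
      · have hlim : Tendsto (fun t : ℝ => (∑ q', N.kernel e q p q' * g q' - g q) * t) atTop atTop :=
          tendsto_id.const_mul_atTop (sub_pos.2 h)
        filter_upwards [hlim.eventually_ge_atTop (u q - N.placeCost e m q p +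
          (∑ q', N.kernel e q p q' * g q') * N.holding p - ∑ q', N.kernel e q p q' * u q')]
          with t ht _
        linarith
    · exact Eventually.of_forall fun t h => absurd h hp
  obtain ⟨t₁, ht₁⟩ := eventually_atTop.1 hev
  set t₀ := max t₁ 0 with ht₀
  obtain ⟨C₂, hC₂⟩ := exists_abs_line_le g u (t₀ - N.maxHolding) t₀
  refine ⟨C₁ + C₂, t₀, fun t ht q => ?_⟩
  refine time_induction hN (s := t₀) (Φ := fun t q => g q * t + u q - (C₁ + C₂) ≤ z t q / e q)
    ?_ ?_ (by linarith [N.maxHolding_nonneg]) q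
  · intro t ht q
    linarith [(abs_le.1 (hC₂ t ht q)).2, hlow t (by linarith [ht.1, le_max_right t₁ 0]) q]
  · intro t ht q ih
    obtain ⟨p, hp, hpz⟩ := (hz.dynamics t ((le_max_right t₁ 0).trans_lt ht) q).1
    simp only [place_term_eq he_pos (z (t - N.holding p))] at hpz
    have h2 := kernel_sum_mono he he_pos hp (ih p hp)
    simp only [sub_eq_add_neg _ (C₁ + C₂)] at h2
    rw [kernel_sum_add_const he he_pos hp] at h2
    rw [← hpz, mul_div_cancel_left₀ _ (he_pos q).ne']
    linarith [ht₁ t ((le_max_left t₁ 0).trans ht.le) q p hp]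

/-- Squeezed between two parallel half-lines, the counters have the slopes of these as growth
rates. -/
theorem isThroughput_of_optimal [DecidableEq Q] (hN : N.NonZeno)
    (he : N.IsStoichiometricInvariant e)
    (he_pos : ∀ q, 0 < e q) (hm : m ∈ markings P) {σ : N.Policy}
    (hσ : ∀ σ' : N.Policy, ∀ q, policyValue e σ m q ≤ policyValue e σ' m q) :
    N.IsThroughput m fun q => e q * policyValue e σ m q := by
  obtain ⟨σ', u, hσ', hg, hu, hopt⟩ := exists_optimal_policy hN he he_pos m
  have hval : ∀ q, policyValue e σ m q = policyValue e σ' m q := fun q =>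
    le_antisymm (hσ σ' q) (hσ' σ q)
  simp only [hval]
  refine ⟨exists_isTrajectory hN m, fun z hz q => ?_⟩
  obtain ⟨C₁, h₁⟩ := hz.exists_le_line hN he he_pos σ' hg hu
  obtain ⟨C₂, t₀, h₂⟩ := hz.exists_line_le hN he he_pos hm (fun q p hp => (hopt q p hp).1)
    (fun q p hp => (hopt q p hp).2)
  have hlim : ∀ C : ℝ, Tendsto
      (fun t : ℝ => e q * policyValue e σ' m q + e q * (u q + C) / t) atTop
      (𝓝 (e q * policyValue e σ' m q)) := fun C => by
    simpa using (tendsto_id.const_div_atTop (e q * (u q + C))).const_add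
      (e q * policyValue e σ' m q)
  refine tendsto_of_tendsto_of_tendsto_of_le_of_le' (hlim (-C₂)) (hlim C₁) ?_ ?_
  · filter_upwards [eventually_ge_atTop t₀, eventually_gt_atTop 0] with t ht ht0
    have h := h₂ t ht q
    rw [le_div_iff₀ (he_pos q)] at h
    rw [le_div_iff₀ ht0, add_mul, div_mul_cancel₀ _ ht0.ne']
    linarith
  · filter_upwards [eventually_gt_atTop 0] with t ht0
    have h := h₁ t ht0.le q
    rw [div_le_iff₀ (he_pos q)] at h
    rw [div_le_iff₀ ht0, add_mul, div_mul_cancel₀ _ ht0.ne']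
    linarith

end Dynamics

end FluidPetriNet

/-! ### Faces of polyhedra -/

section Faces

variable {P : Type*}

theorem IsPolyhedron.of_finite {ι : Type*} [Finite ι] (l : ι → (P → ℝ) →ₗ[ℝ] ℝ) (b : ι → ℝ) :
    IsPolyhedron {x | ∀ i, l i x ≤ b i} := by
  classical
  have := Fintype.ofFinite ι
  exact ⟨Finset.univ.image fun i => (l i, b i), by ext x; simp⟩

theorem isPolyhedron_empty : IsPolyhedron (∅ : Set (P → ℝ)) :=
  ⟨{(0, -1)}, by ext x; simp⟩

theorem IsPolyhedron.convex {L : Set (P → ℝ)} (hL : IsPolyhedron L) : Convex ℝ L := by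
  obtain ⟨s, rfl⟩ := hL
  intro x hx y hy a b ha hb hab c hc
  rw [map_add, map_smul, map_smul, smul_eq_mul, smul_eq_mul]
  calc a * c.1 x + b * c.1 y ≤ a * c.2 + b * c.2 :=
        add_le_add (mul_le_mul_of_nonneg_left (hx c hc) ha)
          (mul_le_mul_of_nonneg_left (hy c hc) hb)
    _ = c.2 := by rw [← add_mul, hab, one_mul]

/-- The subset of a polyhedron, with system of inequalities `s`, on which the inequalities in `J`
are tight. -/
def tightSet (s J : Set (((P → ℝ) →ₗ[ℝ] ℝ) × ℝ)) : Set (P → ℝ) :=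
  {x | (∀ c ∈ s, c.1 x ≤ c.2) ∧ ∀ c ∈ J, c.1 x = c.2}

theorem isPolyhedron_tightSet [Finite P] (s J : Finset (((P → ℝ) →ₗ[ℝ] ℝ) × ℝ)) :
    IsPolyhedron (tightSet (s : Set (((P → ℝ) →ₗ[ℝ] ℝ) × ℝ)) J) := by
  classical
  refine ⟨s ∪ (J ∪ J.image fun c => (-c.1, -c.2)), ?_⟩
  ext x
  simp only [tightSet, mem_ofPred_eq, Finset.mem_coe]
  constructor
  · rintro ⟨h1, h2⟩ c hc
    rcases Finset.mem_union.1 hc with hc | hc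
    · exact h1 c hc
    rcases Finset.mem_union.1 hc with hc | hc
    · exact (h2 c hc).le
    · obtain ⟨d, hd, rfl⟩ := Finset.mem_image.1 hc
      exact (neg_le_neg (h2 d hd).ge : -(d.1 x) ≤ -d.2)
  · intro h
    refine ⟨fun c hc => h c (Finset.mem_union_left _ hc), fun c hc => le_antisymm ?_ ?_⟩
    · exact h c (Finset.mem_union_right _ (Finset.mem_union_left _ hc))
    · exact neg_le_neg_iff.1 (h (-c.1, -c.2) (Finset.mem_union_right _
        (Finset.mem_union_right _ (Finset.mem_image_of_mem _ hc))))

theorem isExposed_tightSet [Finite P] {s J : Finset (((P → ℝ) →ₗ[ℝ] ℝ) × ℝ)} (hJ : J ⊆ s) :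
    IsExposed ℝ {x | ∀ c ∈ s, c.1 x ≤ c.2}
      (tightSet (s : Set (((P → ℝ) →ₗ[ℝ] ℝ) × ℝ)) J) := by
  rintro ⟨w, hw⟩
  -- the sum of the constraints that are made tight
  have hl : ∀ x, LinearMap.toContinuousLinearMap (∑ c ∈ J, c.1) x = ∑ c ∈ J, c.1 x := fun x => by
    simp
  refine ⟨LinearMap.toContinuousLinearMap (∑ c ∈ J, c.1), ?_⟩
  ext x
  simp only [hl, mem_ofPred_eq]
  constructor
  · rintro ⟨h1, h2⟩
    refine ⟨h1, fun y hy => ?_⟩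
    exact Finset.sum_le_sum fun c hc => (hy c (hJ hc)).trans (h2 c hc).ge
  · rintro ⟨h1, h2⟩
    refine ⟨h1, fun c hc => ?_⟩
    have h3 := h2 w hw.1
    rw [Finset.sum_congr rfl fun c hc => hw.2 c hc] at h3
    have h4 : ∑ c ∈ J, c.1 x ≤ ∑ c ∈ J, c.2 := Finset.sum_le_sum fun c hc => h1 c (hJ hc)
    exact (Finset.sum_eq_sum_iff_of_le fun c hc => h1 c (hJ hc)).1 (le_antisymm h4 h3) c hc

/-- A nonempty convex set has a point at which all the inequalities, among a finite family of
valid ones, that are strict somewhere on the set are strict. -/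
theorem exists_forall_lt {G : Set (P → ℝ)} (hG : Convex ℝ G) (hne : G.Nonempty)
    (s : Finset (((P → ℝ) →ₗ[ℝ] ℝ) × ℝ)) (hs : ∀ c ∈ s, ∀ x ∈ G, c.1 x ≤ c.2)
    (hlt : ∀ c ∈ s, ∃ x ∈ G, c.1 x < c.2) : ∃ x ∈ G, ∀ c ∈ s, c.1 x < c.2 := by
  classical
  induction s using Finset.induction_on with
  | empty => exact ⟨hne.some, hne.some_mem, by simp⟩
  | insert c s _ ih =>
    obtain ⟨x, hx, hxs⟩ := ih (fun d hd => hs d (Finset.mem_insert_of_mem hd))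
      fun d hd => hlt d (Finset.mem_insert_of_mem hd)
    obtain ⟨y, hy, hyc⟩ := hlt c (Finset.mem_insert_self c s)
    refine ⟨(1 / 2 : ℝ) • x + (1 / 2 : ℝ) • y,
      hG hx hy (by norm_num) (by norm_num) (by norm_num), fun d hd => ?_⟩
    rw [map_add, map_smul, map_smul, smul_eq_mul, smul_eq_mul]
    have h1 := hs d hd x hx
    have h2 := hs d hd y hy
    rcases Finset.mem_insert.1 hd with rfl | hd
    · linarith
    · linarith [hxs d hd]

/-- A nonempty convex extreme subset of a polyhedron is given by its tight inequalities: a segment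
issued from a point at which no other inequality is tight can be prolonged. -/
theorem IsExtreme.eq_tightSet {s : Finset (((P → ℝ) →ₗ[ℝ] ℝ) × ℝ)} {G : Set (P → ℝ)}
    (h : IsExtreme ℝ {x | ∀ c ∈ s, c.1 x ≤ c.2} G) (hG : Convex ℝ G) (hne : G.Nonempty) :
    ∃ J ⊆ s, G = tightSet (s : Set (((P → ℝ) →ₗ[ℝ] ℝ) × ℝ)) J := by
  classical
  refine ⟨s.filter fun c => ∀ x ∈ G, c.1 x = c.2, Finset.filter_subset _ _, ?_⟩
  refine Subset.antisymm (fun x hx => ⟨h.subset hx, fun c hc => (Finset.mem_filter.1 hc).2 x hx⟩) ?_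
  rintro y ⟨hy, hyJ⟩
  obtain ⟨x, hx, hxs⟩ := exists_forall_lt hG hne (s.filter fun c => ¬ ∀ x ∈ G, c.1 x = c.2)
    (fun c hc x hx => h.subset hx c (Finset.mem_filter.1 hc).1) fun c hc => by
      obtain ⟨hcs, hc⟩ := Finset.mem_filter.1 hc
      push Not at hc
      obtain ⟨x, hx, hxc⟩ := hc
      exact ⟨x, hx, lt_of_le_of_ne (h.subset hx c hcs) hxc⟩
  have hval : ∀ (c : ((P → ℝ) →ₗ[ℝ] ℝ) × ℝ) (ε : ℝ),
      c.1 (x + ε • (x - y)) = c.1 x + ε * (c.1 x - c.1 y) := fun c ε => by simp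
  have hev : ∀ᶠ ε in 𝓝[>] (0 : ℝ), ∀ c ∈ s, c.1 (x + ε • (x - y)) ≤ c.2 := by
    rw [Filter.eventually_all_finset]
    intro c hc
    simp only [hval]
    by_cases hcJ : ∀ x ∈ G, c.1 x = c.2
    · have h1 : c.1 y = c.2 := hyJ c (by simpa using ⟨hc, hcJ⟩)
      exact Eventually.of_forall fun ε => by rw [hcJ x hx, h1]; simp
    · have h1 : c.1 x < c.2 := hxs c (Finset.mem_filter.2 ⟨hc, hcJ⟩)
      have h2 : Tendsto (fun ε : ℝ => c.1 x + ε * (c.1 x - c.1 y)) (𝓝 0) (𝓝 (c.1 x)) := by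
        have : Continuous fun ε : ℝ => c.1 x + ε * (c.1 x - c.1 y) := by fun_prop
        simpa using this.tendsto 0
      filter_upwards [(h2.mono_left nhdsWithin_le_nhds).eventually_lt_const h1] with ε hε
      exact hε.le
  obtain ⟨ε, hε, hε0⟩ := (hev.and self_mem_nhdsWithin).exists
  have hε0 : 0 < ε := hε0
  refine h.left_mem_of_mem_openSegment hy hε hx ⟨ε / (1 + ε), 1 / (1 + ε), by positivity,
    by positivity, by field_simp; ring, ?_⟩
  ext i
  simp only [Pi.add_apply, Pi.smul_apply, Pi.sub_apply, smul_eq_mul]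
  field_simp
  ring

theorem IsPolyhedron.isExposed_of_isExtreme [Finite P] {L G : Set (P → ℝ)} (hL : IsPolyhedron L)
    (h : IsExtreme ℝ L G) (hG : Convex ℝ G) : IsExposed ℝ L G := by
  obtain ⟨s, rfl⟩ := hL
  rcases G.eq_empty_or_nonempty with rfl | hne
  · exact isExposed_empty
  · obtain ⟨J, hJ, rfl⟩ := h.eq_tightSet hG hne
    exact isExposed_tightSet hJ

/-- Faces of faces of a polyhedron are faces. -/
theorem IsPolyhedron.isExposed_trans [Finite P] {L G H : Set (P → ℝ)} (hL : IsPolyhedron L)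
    (hG : IsExposed ℝ L G) (hH : IsExposed ℝ G H) : IsExposed ℝ L H :=
  hL.isExposed_of_isExtreme (hG.isExtreme.trans hH.isExtreme) (hH.convex (hG.convex hL.convex))

theorem IsPolyhedron.of_isExposed [Finite P] {L G : Set (P → ℝ)} (hL : IsPolyhedron L)
    (hG : IsExposed ℝ L G) : IsPolyhedron G := by
  have hconv := hG.convex hL.convex
  obtain ⟨s, rfl⟩ := hL
  rcases G.eq_empty_or_nonempty with rfl | hne
  · exact isPolyhedron_empty
  · obtain ⟨J, -, rfl⟩ := hG.isExtreme.eq_tightSet hconv hne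
    exact isPolyhedron_tightSet s J

theorem IsPolyhedron.finite_faces {L : Set (P → ℝ)} (hL : IsPolyhedron L) :
    {G | IsExposed ℝ L G}.Finite := by
  have hconv := hL.convex
  obtain ⟨s, rfl⟩ := hL
  refine ((s.powerset.finite_toSet.image fun J : Finset (((P → ℝ) →ₗ[ℝ] ℝ) × ℝ) =>
    tightSet (s : Set (((P → ℝ) →ₗ[ℝ] ℝ) × ℝ)) J).insert ∅).subset fun G hG => ?_
  rcases G.eq_empty_or_nonempty with rfl | hne
  · exact mem_insert _ _
  · obtain ⟨J, hJ, rfl⟩ := IsExtreme.eq_tightSet (IsExposed.isExtreme hG)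
      (IsExposed.convex hG hconv) hne
    exact mem_insert_of_mem _ ⟨J, Finset.mem_coe.2 (Finset.mem_powerset.2 hJ), rfl⟩

theorem IsPolyhedron.isClosed [Finite P] {L : Set (P → ℝ)} (hL : IsPolyhedron L) :
    IsClosed L := by
  obtain ⟨s, rfl⟩ := hL
  simp only [ofPred_forall]
  exact isClosed_biInter fun c _ =>
    isClosed_le (LinearMap.continuous_of_finiteDimensional c.1) continuous_const

theorem markings_eq_pi (P : Type*) : markings P = univ.pi fun _ => Ici 0 := by
  ext m
  simp [markings, Pi.le_def]

theorem isPolyhedron_markings [Finite P] : IsPolyhedron (markings P) := by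
  convert IsPolyhedron.of_finite (fun p : P => -LinearMap.proj p) fun _ => 0 using 1
  ext m
  simp [markings]

theorem markings_subset_closure_interior [Finite P] :
    markings P ⊆ closure (interior (markings P)) := by
  rw [markings_eq_pi, interior_pi_set finite_univ]
  simp only [interior_Ici]
  rw [closure_pi_set]
  simp

end Faces

/-! ### Finite closed covers -/

section Covers

variable {X ι : Type*} [TopologicalSpace X] [BaireSpace X] [Countable ι] {C : ι → Set X}

theorem exists_interior_inter_nonempty (hC : ∀ i, IsClosed (C i)) {V : Set X} (hV : IsOpen V)
    (hne : V.Nonempty) (hcov : V ⊆ ⋃ i, C i) : ∃ i, (interior (C i) ∩ V).Nonempty := by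
  let D : Option ι → Set X := fun o => o.elim Vᶜ C
  have hD : ∀ o, IsClosed (D o) := fun o => by
    cases o with
    | none => exact hV.isClosed_compl
    | some i => exact hC i
  have hU : ⋃ o, D o = univ := by
    refine eq_univ_of_forall fun x => ?_
    by_cases hx : x ∈ V
    · obtain ⟨i, hi⟩ := mem_iUnion.1 (hcov hx)
      exact mem_iUnion.2 ⟨some i, hi⟩
    · exact mem_iUnion.2 ⟨none, hx⟩
  obtain ⟨x, hxV, hx⟩ := (dense_iUnion_interior_of_closed hD hU).inter_open_nonempty V hV hne
  obtain ⟨o, ho⟩ := mem_iUnion.1 hx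
  cases o with
  | none => exact absurd hxV (interior_subset ho)
  | some i => exact ⟨i, x, ho, hxV⟩

/-- In a finite closed cover of a set contained in the closure of its interior, the members with
nonempty interior suffice. -/
theorem biUnion_interior_nonempty_eq [Finite ι] (hC : ∀ i, IsClosed (C i)) {Y : Set X}
    (hY : Y ⊆ closure (interior Y)) (hcov : ⋃ i, C i = Y) :
    ⋃ i ∈ {i | (interior (C i)).Nonempty}, C i = Y := by
  set W := ⋃ i ∈ {i | (interior (C i)).Nonempty}, C i with hW
  refine Subset.antisymm (iUnion₂_subset fun i _ => hcov ▸ subset_iUnion C i) fun x hx => ?_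
  by_contra hxW
  have hWc : IsClosed W := (toFinite _).isClosed_biUnion fun i _ => hC i
  obtain ⟨y, hyW, hyY⟩ := mem_closure_iff.1 (hY hx) _ hWc.isOpen_compl hxW
  obtain ⟨i, z, hzi, hzW, -⟩ := exists_interior_inter_nonempty hC
    (hWc.isOpen_compl.inter isOpen_interior) ⟨y, hyW, hyY⟩
    (by rw [hcov]; exact inter_subset_right.trans interior_subset)
  exact hzW (mem_iUnion₂.2 ⟨i, ⟨z, hzi⟩, interior_subset hzi⟩)

end Covers

/-! ### Minima of linear functions -/

section Minima

variable {P ι : Type*} {f : ι → (P → ℝ) →ₗ[ℝ] ℝ} {h : (P → ℝ) → ℝ}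

theorem concaveOn_of_isLeast (hh : ∀ m ∈ markings P, IsLeast (range fun i => f i m) (h m)) :
    ConcaveOn ℝ (markings P) h := by
  have hconv : Convex ℝ (markings P) := by
    rw [markings_eq_pi]
    exact convex_pi fun _ _ => convex_Ici 0
  refine ⟨hconv, fun x hx y hy a b ha hb hab => ?_⟩
  obtain ⟨i, hi⟩ := (hh _ (hconv hx hy ha hb hab)).1
  simp only [← hi, map_add, map_smul]
  exact add_le_add (smul_le_smul_of_nonneg_left ((hh x hx).2 ⟨i, rfl⟩) ha)
    (smul_le_smul_of_nonneg_left ((hh y hy).2 ⟨i, rfl⟩) hb)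

theorem isPiecewiseAffineOn_of_isLeast [Finite P] [Finite ι]
    (hh : ∀ m ∈ markings P, IsLeast (range fun i => f i m) (h m)) :
    IsPiecewiseAffineOn (markings P) h := by
  refine ⟨range fun i => {m | m ∈ markings P ∧ ∀ j, f i m ≤ f j m}, finite_range _, ?_, ?_, ?_⟩
  · rintro _ ⟨i, rfl⟩
    convert IsPolyhedron.of_finite
      (Sum.elim (fun p : P => -LinearMap.proj p) fun j : ι => f i - f j) 0 using 1
    ext m
    simp [markings]
  · ext m
    simp only [sUnion_range, mem_iUnion]
    refine ⟨fun ⟨i, hi⟩ => hi.1, fun hm => ?_⟩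
    obtain ⟨i, hi⟩ := (hh m hm).1
    exact ⟨i, hm, fun j => hi.trans_le ((hh m hm).2 ⟨j, rfl⟩)⟩
  · rintro _ ⟨i, rfl⟩
    refine ⟨(f i).toAffineMap, fun m hm => ?_⟩
    exact (hh m hm.1).unique ⟨⟨i, rfl⟩, by rintro _ ⟨j, rfl⟩; exact hm.2 j⟩

end Minima

/-! ### The complex of the sets of simultaneous minimizers -/

section ArgminComplex

variable {P ι κ : Type*} {f : ι → κ → (P → ℝ) →ₗ[ℝ] ℝ}

/-- The indices that minimize all the families `i ↦ f i k m` simultaneously. -/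
def commonArgmin (f : ι → κ → (P → ℝ) →ₗ[ℝ] ℝ) (m : P → ℝ) : Set ι :=
  {i | ∀ k j, f i k m ≤ f j k m}

/-- The markings at which all the elements of `S` are simultaneous minimizers. -/
def argminRegion (f : ι → κ → (P → ℝ) →ₗ[ℝ] ℝ) (S : Set ι) : Set (P → ℝ) :=
  {m | m ∈ markings P ∧ S ⊆ commonArgmin f m}

/-- The closure of the set of the markings whose set of simultaneous minimizers is `S`. -/
def argminCell (f : ι → κ → (P → ℝ) →ₗ[ℝ] ℝ) (S : Set ι) : Set (P → ℝ) :=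
  closure {m | m ∈ markings P ∧ commonArgmin f m = S}

theorem isPolyhedron_argminRegion [Finite P] [Finite ι] [Finite κ] (S : Set ι) :
    IsPolyhedron (argminRegion f S) := by
  convert IsPolyhedron.of_finite (Sum.elim (fun p : P => -LinearMap.proj p)
    fun x : S × κ × ι => f x.1 x.2.1 - f x.2.2 x.2.1) 0 using 1
  ext m
  simp [argminRegion, commonArgmin, markings, Set.subset_def]

/-- The closure of a nonempty stratum is given by the weak inequalities: the open segment between
a point of the region and a point of the stratum lies in the stratum. -/
theorem argminCell_eq_argminRegion [Finite P] [Finite ι] [Finite κ]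
    {m₀ : P → ℝ} (hm₀ : m₀ ∈ markings P) (hne : (commonArgmin f m₀).Nonempty) :
    argminCell f (commonArgmin f m₀) = argminRegion f (commonArgmin f m₀) := by
  refine Subset.antisymm (closure_minimal (fun m hm => ⟨hm.1, hm.2.ge⟩)
    (isPolyhedron_argminRegion _).isClosed) fun m hm => ?_
  have hseg : openSegment ℝ m m₀ ⊆
      {m | m ∈ markings P ∧ commonArgmin f m = commonArgmin f m₀} := by
    rintro _ ⟨a, b, ha, hb, hab, rfl⟩
    have hreg := (isPolyhedron_argminRegion (f := f) (commonArgmin f m₀)).convex hm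
      (⟨hm₀, Subset.rfl⟩ : m₀ ∈ argminRegion f _) ha.le hb.le hab
    refine ⟨hreg.1, Subset.antisymm (fun j hj k i => ?_) hreg.2⟩
    obtain ⟨i₀, hi₀⟩ := hne
    have h1 := hj k i₀
    simp only [map_add, map_smul, smul_eq_mul] at h1
    have h2 := mul_le_mul_of_nonneg_left (hm.2 hi₀ k j) ha.le
    exact (le_of_mul_le_mul_left (by linarith) hb : f j k m₀ ≤ f i₀ k m₀).trans (hi₀ k i)
  exact closure_mono hseg (closure_openSegment (𝕜 := ℝ) m m₀ ▸ left_mem_segment ℝ m m₀)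

theorem argminCell_eq_or [Finite P] [Finite ι] [Finite κ]
    (hne : ∀ m ∈ markings P, (commonArgmin f m).Nonempty) (S : Set ι) :
    argminCell f S = ∅ ∨ S.Nonempty ∧ argminCell f S = argminRegion f S := by
  by_cases h : ∃ m ∈ markings P, commonArgmin f m = S
  · obtain ⟨m, hm, rfl⟩ := h
    exact Or.inr ⟨hne m hm, argminCell_eq_argminRegion hm (hne m hm)⟩
  · left
    rw [argminCell, closure_empty_iff, eq_empty_iff_forall_notMem]
    exact fun m hm => h ⟨m, hm⟩

theorem isPolyhedron_argminCell [Finite P] [Finite ι] [Finite κ]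
    (hne : ∀ m ∈ markings P, (commonArgmin f m).Nonempty) (S : Set ι) :
    IsPolyhedron (argminCell f S) := by
  rcases argminCell_eq_or hne S with h | ⟨-, h⟩
  · exact h ▸ isPolyhedron_empty
  · exact h ▸ isPolyhedron_argminRegion S

theorem argminRegion_union (S T : Set ι) :
    argminRegion f (S ∪ T) = argminRegion f S ∩ argminRegion f T := by
  ext m
  simp only [argminRegion, mem_inter_iff, mem_ofPred_eq, union_subset_iff]
  tauto

/-- Adding minimizers selects a face, exposed by the sum of the differences between the added
functions and the minimum. -/
theorem isExposed_argminRegion_union [Finite P] [Finite ι] [Finite κ] {S : Set ι}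
    (hS : S.Nonempty) (T : Set ι) :
    IsExposed ℝ (argminRegion f S) (argminRegion f (S ∪ T)) := by
  classical
  have := Fintype.ofFinite T
  have := Fintype.ofFinite κ
  obtain ⟨i₀, hi₀⟩ := hS
  rintro ⟨w, hw⟩
  have hl : ∀ x, LinearMap.toContinuousLinearMap (∑ y : T × κ, (f i₀ y.2 - f y.1 y.2)) x =
      ∑ y : T × κ, (f i₀ y.2 x - f y.1 y.2 x) := fun x => by simp
  have hle : ∀ x ∈ argminRegion f S, ∀ y : T × κ, f i₀ y.2 x - f y.1 y.2 x ≤ 0 :=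
    fun x hx y => sub_nonpos.2 (hx.2 hi₀ y.2 y.1)
  have hzero : ∀ x ∈ argminRegion f (S ∪ T), ∀ y : T × κ, f i₀ y.2 x - f y.1 y.2 x = 0 := by
    intro x hx y
    rw [argminRegion_union] at hx
    exact le_antisymm (hle x hx.1 y) (sub_nonneg.2 (hx.2.2 y.1.2 y.2 i₀))
  refine ⟨LinearMap.toContinuousLinearMap (∑ y : T × κ, (f i₀ y.2 - f y.1 y.2)), ?_⟩
  ext x
  simp only [hl, mem_ofPred_eq]
  constructor
  · intro hx
    refine ⟨(argminRegion_union S T ▸ hx).1, fun y hy => ?_⟩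
    rw [Finset.sum_eq_zero fun z _ => hzero x hx z]
    exact Finset.sum_nonpos fun z _ => hle y hy z
  · rintro ⟨hx, hmax⟩
    rw [argminRegion_union]
    refine ⟨hx, hx.1, fun i hi k j => ?_⟩
    have h1 := hmax w (argminRegion_union S T ▸ hw).1
    rw [Finset.sum_eq_zero fun z _ => hzero w hw z] at h1
    have h2 := (Finset.sum_eq_zero_iff_of_nonpos fun z _ => hle x hx z).1
      (le_antisymm (Finset.sum_nonpos fun z _ => hle x hx z) h1) (⟨i, hi⟩, k) (Finset.mem_univ _)
    exact (sub_eq_zero.1 h2).ge.trans (hx.2 hi₀ k j)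

theorem isPolyhedralComplex_argminCell [Finite P] [Finite ι] [Finite κ]
    (hne : ∀ m ∈ markings P, (commonArgmin f m).Nonempty) :
    IsPolyhedralComplex {G | ∃ S, IsExposed ℝ (argminCell f S) G} := by
  have hinter : ∀ L₁, (∃ S, IsExposed ℝ (argminCell f S) L₁) →
      ∀ L₂, (∃ S, IsExposed ℝ (argminCell f S) L₂) → IsExposed ℝ L₁ (L₁ ∩ L₂) := by
    rintro L₁ ⟨S, hS⟩ L₂ ⟨T, hT⟩
    rcases argminCell_eq_or hne S with h1 | ⟨hS0, h1⟩
    · rw [h1] at hS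
      rw [subset_empty_iff.1 hS.subset, empty_inter]
    rcases argminCell_eq_or hne T with h2 | ⟨hT0, h2⟩
    · rw [h2] at hT
      rw [subset_empty_iff.1 hT.subset, inter_empty]
      exact isExposed_empty
    rw [h1] at hS
    rw [h2] at hT
    -- both members induce faces on the common face of the two regions
    set D := argminRegion f (S ∪ T) with hD
    have hDS : IsExposed ℝ (argminRegion f S) D := isExposed_argminRegion_union hS0 T
    have hDT : IsExposed ℝ (argminRegion f T) D := by
      rw [hD, union_comm]
      exact isExposed_argminRegion_union hT0 S
    have h3 : IsExposed ℝ D (L₁ ∩ D) := (hS.inter hDS).mono hDS.subset inter_subset_right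
    have h4 : IsExposed ℝ D (L₂ ∩ D) := (hT.inter hDT).mono hDT.subset inter_subset_right
    have h5 : L₁ ∩ L₂ = (L₁ ∩ D) ∩ (L₂ ∩ D) := by
      have : L₁ ∩ L₂ ⊆ D := by
        rw [hD, argminRegion_union]
        exact inter_subset_inter hS.subset hT.subset
      rw [← inter_inter_distrib_right, inter_eq_self_of_subset_left this]
    rw [h5]
    refine ((isPolyhedron_argminRegion S).isExposed_trans hDS (h3.inter h4)).mono hS.subset ?_
    exact inter_subset_left.trans inter_subset_left
  refine ⟨?_, ?_, ?_, fun L₁ h₁ L₂ h₂ => ⟨hinter L₁ h₁ L₂ h₂, ?_⟩⟩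
  · have : {G | ∃ S, IsExposed ℝ (argminCell f S) G} =
        ⋃ S, {G | IsExposed ℝ (argminCell f S) G} := by
      ext G
      simp
    rw [this]
    exact finite_iUnion fun S => (isPolyhedron_argminCell hne S).finite_faces
  · rintro L ⟨S, hS⟩
    exact (isPolyhedron_argminCell hne S).of_isExposed hS
  · rintro L ⟨S, hS⟩ G hG
    exact ⟨S, (isPolyhedron_argminCell hne S).isExposed_trans hS hG⟩
  · rw [inter_comm]
    exact hinter L₂ h₂ L₁ h₁

theorem argminCell_subset_markings [Finite P] (S : Set ι) : argminCell f S ⊆ markings P :=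
  closure_minimal (fun _ hm => hm.1) isPolyhedron_markings.isClosed

theorem iUnion_argminCell [Finite P] : ⋃ S, argminCell f S = markings P :=
  Subset.antisymm (iUnion_subset argminCell_subset_markings) fun m hm =>
    mem_iUnion.2 ⟨commonArgmin f m, subset_closure ⟨hm, rfl⟩⟩

theorem sUnion_faces_argminCell [Finite P] :
    ⋃₀ {G | ∃ S, IsExposed ℝ (argminCell f S) G} = markings P := by
  refine Subset.antisymm (sUnion_subset ?_) fun m hm => ?_
  · rintro G ⟨S, hS⟩
    exact hS.subset.trans (argminCell_subset_markings S)
  · obtain ⟨S, hS⟩ := mem_iUnion.1 (iUnion_argminCell (f := f) ▸ hm)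
    exact ⟨_, ⟨S, IsExposed.refl _⟩, hS⟩

theorem biUnion_argminCell [Finite P] [Finite ι] :
    ⋃ S ∈ {S | (interior (argminCell f S)).Nonempty}, argminCell f S = markings P :=
  biUnion_interior_nonempty_eq (fun _ => isClosed_closure) markings_subset_closure_interior
    iUnion_argminCell

variable {h : (P → ℝ) → κ → ℝ}

theorem eqOn_argminCell [Finite P] [Finite ι] [Finite κ]
    (hne : ∀ m ∈ markings P, (commonArgmin f m).Nonempty)
    (hh : ∀ m ∈ markings P, ∀ k, IsLeast (range fun i => f i k m) (h m k)) {S : Set ι} {i : ι}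
    (hi : i ∈ S) (k : κ) : EqOn (fun m => h m k) (f i k) (argminCell f S) := by
  intro m hm
  rcases argminCell_eq_or hne S with h1 | ⟨-, h1⟩
  · exact ((h1 ▸ hm : m ∈ (∅ : Set (P → ℝ)))).elim
  · rw [h1] at hm
    exact (hh m hm.1 k).unique
      ⟨⟨i, rfl⟩, by rintro _ ⟨j, rfl⟩; exact hm.2 hi k j⟩

theorem isAffineOn_argminCell [Finite P] [Finite ι] [Finite κ]
    (hne : ∀ m ∈ markings P, (commonArgmin f m).Nonempty)
    (hh : ∀ m ∈ markings P, ∀ k, IsLeast (range fun i => f i k m) (h m k)) (S : Set ι) (k : κ) :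
    IsAffineOn (argminCell f S) fun m => h m k := by
  rcases argminCell_eq_or hne S with h1 | ⟨⟨i, hi⟩, -⟩
  · exact ⟨0, by rw [h1]; exact eqOn_empty _ _⟩
  · exact ⟨(f i k).toAffineMap, eqOn_argminCell hne hh hi k⟩

/-- A full-dimensional region on which the minima are affine lies in a full-dimensional cell: it
overlaps one, and the affine functions agreeing on the overlap agree everywhere. -/
theorem exists_subset_argminCell [Finite P] [Finite ι] [Finite κ]
    (hne : ∀ m ∈ markings P, (commonArgmin f m).Nonempty)
    (hh : ∀ m ∈ markings P, ∀ k, IsLeast (range fun i => f i k m) (h m k)) {R : Set (P → ℝ)}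
    (hR : R ⊆ markings P) (hRint : (interior R).Nonempty)
    (haff : ∀ k, IsAffineOn R fun m => h m k) :
    ∃ S, (interior (argminCell f S)).Nonempty ∧ R ⊆ argminCell f S := by
  have := Fintype.ofFinite P
  obtain ⟨S, x, hxS, hxR⟩ := exists_interior_inter_nonempty (C := argminCell f)
    (fun _ => isClosed_closure) isOpen_interior hRint
    (by rw [iUnion_argminCell]; exact interior_subset.trans hR)
  refine ⟨S, ⟨x, hxS⟩, fun m hm => ?_⟩
  rcases argminCell_eq_or hne S with h1 | ⟨-, h1⟩
  · exact ((h1 ▸ interior_subset hxS : x ∈ (∅ : Set (P → ℝ)))).elim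
  rw [h1]
  refine ⟨hR hm, fun i hi k j => ?_⟩
  obtain ⟨a, ha⟩ := haff k
  have hopen : IsOpen (interior (argminCell f S) ∩ interior R) :=
    isOpen_interior.inter isOpen_interior
  have heq : a = (f i k).toAffineMap :=
    AffineMap.ext_on (hopen.affineSpan_eq_top ⟨x, hxS, hxR⟩) fun y hy =>
      (ha (interior_subset hy.2)).symm.trans
        (eqOn_argminCell hne hh hi k (interior_subset hy.1))
  have hmk : h m k = f i k m := by
    have := ha hm
    rw [heq] at this
    exact this
  rw [← hmk]
  exact (hh m (hR hm) k).2 ⟨j, rfl⟩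

end ArgminComplex

/-! ### The throughput complex -/

namespace FluidPetriNet

section Throughput

variable {P Q : Type*} [Fintype P] [Fintype Q] [DecidableEq Q] {N : FluidPetriNet P Q} {e : Q → ℝ}

/-- The throughput of the transition `q` under the policy `σ`, as a linear function of the
marking. -/
noncomputable def policyThroughput (e : Q → ℝ) (σ : N.Policy) (q : Q) : (P → ℝ) →ₗ[ℝ] ℝ where
  toFun m := e q * policyValue e σ m q
  map_add' m m' := by
    have h : policyCost e σ (m + m') = policyCost e σ m + policyCost e σ m' := by
      ext q
      simp only [policyCost, Pi.add_apply]
      ring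
    simp only [policyValue, h, dotProduct_add, add_div, mul_add, Finset.sum_add_distrib]
  map_smul' a m := by
    have h : policyCost e σ (a • m) = a • policyCost e σ m := by
      ext q
      simp only [policyCost, Pi.smul_apply, smul_eq_mul]
      ring
    simp only [policyValue, h, dotProduct_smul, smul_eq_mul, mul_div_assoc, RingHom.id_apply,
      mul_left_comm _ a, ← Finset.mul_sum]

theorem policyThroughput_apply (e : Q → ℝ) (σ : N.Policy) (q : Q) (m : P → ℝ) :
    policyThroughput e σ q m = e q * policyValue e σ m q := rfl

theorem optimalPolicies_eq_commonArgmin (he_pos : ∀ q, 0 < e q) (U : Set Q) (m : P → ℝ) :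
    N.optimalPolicies e U m =
      commonArgmin (fun (σ : N.Policy) (q : U) => policyThroughput e σ q) m := by
  ext σ
  simp only [optimalPolicies, commonArgmin, policyThroughput_apply, mem_ofPred_eq,
    mul_le_mul_iff_right₀ (he_pos _), Subtype.forall]

theorem cell_eq_argminCell (he_pos : ∀ q, 0 < e q) (U : Set Q) :
    N.cell e U = argminCell (fun (σ : N.Policy) (q : U) => policyThroughput e σ q) := by
  ext S
  simp only [cell, argminCell, optimalPolicies_eq_commonArgmin he_pos]

end Throughput

end FluidPetriNet

theorem mainTheorem2 {P Q : Type*} [Fintype P] [Fintype Q] [DecidableEq Q]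
    (N : FluidPetriNet P Q) (hN : N.NonZeno) (e : Q → ℝ)
    (he : N.IsStoichiometricInvariant e) (he_pos : ∀ q, 0 < e q) :
    -- the quantities in the formula are well defined
    (∀ σ : N.Policy,
      (∀ i j, Tendsto (cesaroMean (FluidPetriNet.policyMatrix e σ) i j) atTop
        (𝓝 (spectralProjector (FluidPetriNet.policyMatrix e σ) i j))) ∧
      ∀ F, IsFinalClass (FluidPetriNet.policyMatrix e σ) F →
        (∀ μ, IsInvariantMeasureOn (FluidPetriNet.policyMatrix e σ) F μ ↔
          μ = invariantMeasure (FluidPetriNet.policyMatrix e σ) F) ∧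
        0 < invariantMeasure (FluidPetriNet.policyMatrix e σ) F ⬝ᵥ
          FluidPetriNet.policyTime σ) ∧
    ∃ ρ : (P → ℝ) → Q → ℝ,
      -- the throughput exists and is given by the formula
      (∀ m ∈ markings P, N.IsThroughput m (ρ m) ∧
        ∀ q, IsLeast (range fun σ : N.Policy => e q * FluidPetriNet.policyValue e σ m q)
          (ρ m q)) ∧
      -- it is a concave piecewise affine function of the initial marking
      (∀ q, ConcaveOn ℝ (markings P) (fun m => ρ m q) ∧
        IsPiecewiseAffineOn (markings P) (fun m => ρ m q)) ∧
      -- the throughput complex of any set of transitions, e.g. a single one, or all of them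
      ∀ U : Set Q,
        IsPolyhedralComplex (N.throughputComplex e U) ∧
        ⋃₀ (N.throughputComplex e U) = markings P ∧
        (∀ G ∈ N.throughputComplex e U, ∀ q ∈ U, IsAffineOn G (fun m => ρ m q)) ∧
        -- the full-dimensional cells cover the space of markings
        (⋃ S ∈ {S : Set N.Policy | (interior (N.cell e U S)).Nonempty}, N.cell e U S) =
          markings P ∧
        -- and they are the maximal regions with nonempty interior where the throughput is affine
        ∀ R ⊆ markings P, (interior R).Nonempty →
          (∀ q ∈ U, IsAffineOn R (fun m => ρ m q)) → 
          ∃ S : Set N.Policy, (interior (N.cell e U S)).Nonempty ∧ R ⊆ N.cell e U S := by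
  classical
  have hA := fun σ : N.Policy => FluidPetriNet.policyMatrix_mem_rowStochastic he he_pos σ
  refine ⟨fun σ => ⟨tendsto_cesaroMean (hA σ), fun F hF => ⟨isInvariantMeasureOn_iff (hA σ) hF,
    FluidPetriNet.invariantMeasure_dotProduct_policyTime_pos hN he he_pos σ hF⟩⟩, ?_⟩
  choose σ hσ using fun m : P → ℝ =>
    (FluidPetriNet.exists_optimal_policy hN he he_pos m).imp fun σ h => h.choose_spec.1
  have hle : ∀ m (σ' : N.Policy) q,
      FluidPetriNet.policyThroughput e (σ m) q m ≤ FluidPetriNet.policyThroughput e σ' q m :=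
    fun m σ' q => mul_le_mul_of_nonneg_left (hσ m σ' q) (he_pos q).le
  set ρ : (P → ℝ) → Q → ℝ := fun m q => FluidPetriNet.policyThroughput e (σ m) q m with hρ
  have hleast : ∀ m q,
      IsLeast (range fun σ' : N.Policy => FluidPetriNet.policyThroughput e σ' q m) (ρ m q) :=
    fun m q => ⟨⟨σ m, rfl⟩, by rintro _ ⟨σ', rfl⟩; exact hle m σ' q⟩
  refine ⟨ρ, fun m hm => ⟨FluidPetriNet.isThroughput_of_optimal hN he he_pos hm (hσ m),
    hleast m⟩, fun q => ⟨concaveOn_of_isLeast fun m _ => hleast m q,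
    isPiecewiseAffineOn_of_isLeast fun m _ => hleast m q⟩, fun U => ?_⟩
  -- some policy minimizes all the values, so that only nonempty sets of policies have
  -- a nonempty cell
  have hne : ∀ m ∈ markings P, (commonArgmin (fun (σ : N.Policy) (q : U) =>
      FluidPetriNet.policyThroughput e σ q) m).Nonempty := fun m _ =>
    ⟨σ m, fun q σ' => hle m σ' q⟩
  have hU : ∀ m ∈ markings P, ∀ q : U, IsLeast (range fun σ' : N.Policy =>
      FluidPetriNet.policyThroughput e σ' q m) (ρ m q) := fun m _ q => hleast m q
  rw [FluidPetriNet.throughputComplex, FluidPetriNet.cell_eq_argminCell he_pos]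
  refine ⟨isPolyhedralComplex_argminCell hne, sUnion_faces_argminCell, ?_, biUnion_argminCell,
    fun R hR hRint haff => ?_⟩
  · rintro G ⟨S, hS⟩ q hq
    obtain ⟨a, ha⟩ := isAffineOn_argminCell (h := fun m (q : U) => ρ m q) hne hU S ⟨q, hq⟩
    exact ⟨a, ha.mono hS.subset⟩
  · exact exists_subset_argminCell (h := fun m (q : U) => ρ m q) hne hU hR hRint
      fun q => haff q q.2
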